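/- Let $n\ge 2$ be an integer and $p\ge n$ a real number. Write $B_R$ and $S_R$ for the open ball and the sphere of radius $R$ centred at the origin of $\mathbb{R}^n$. Let $A\colon[0,\infty)\to\mathbb{R}$ be continuous with $\delta\le A(t)\le L$ for all $t\ge 0$, where $\delta,L>0$ are constants, and suppose that $t\mapsto t^{p-1}A(t)$ is strictly increasing on $(0,\infty)$. Let $f$ be locally integrable on $\mathbb{R}^n\setminus\overline{B_1}$ and suppose that, for some constants $C_f,\epsilon>0$ and $R_0\ge 1$, $$|f(x)|\le C_f\,|x|^{-(p+\epsilon)}\qquad\text{for almost every } x \text{ with } |x|\ge R_0 .$$ Let $u\in W^{1,p}_{loc}(\mathbb{R}^n\setminus\overline{B_1})$ be a bounded weak solution of $$-\operatorname{div}\big(|\nabla u|^{p-2}A(|\nabla u|)\nabla u\big)=f\quad\text{in }\mathbb{R}^n\setminus\overline{B_1},$$ that is, $\int |\nabla u|^{p-2}A(|\nabla u|)\,\nabla u\cdot\nabla\eta\,dx=\int f\eta\,dx$ for all $\eta\in C_c^\infty(\mathbb{R}^n\setminus\overline{B_1})$, and suppose that $u$ is continuous in $\mathbb{R}^n\setminus\overline{B_1}$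 (so that its values on spheres are meaningful). Put $$m_R=\inf_{S_R}u,\qquad M_R=\sup_{S_R}u,\qquad C_0=\left(\frac{C_f}{\delta(p-n+\epsilon)}\right)^{\frac1{p-1}}\frac{p-1}{\epsilon}.$$ Then, for every $R\ge R_0$ with $R>1$, $$m_R-C_0R^{-\frac{\epsilon}{p-1}}\le u(x)\le M_R+C_0R^{-\frac{\epsilon}{p-1}}\qquad\text{for all }x\in\mathbb{R}^n\setminus B_R .$$ In particular, if $R_0=1$ and $u$ is continuous on $\mathbb{R}^n\setminus B_1$, then $$\inf_{S_1}u-C_0\le u\le\sup_{S_1}u+C_0\qquad\text{on }\mathbb{R}^n\setminus B_1 .$$ -/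

import Mathlib

open MeasureTheory Set
open scoped ENNReal ContDiff

namespace ExteriorProblem

/-- `ℝⁿ` with its Euclidean norm. -/
abbrev E (n : ℕ) : Type := EuclideanSpace ℝ (Fin n)

/-- The exterior domain `ℝⁿ \ closure B₁ = {x : |x| > 1}`. -/
def exterior (n : ℕ) : Set (E n) := (Metric.closedBall (0 : E n) 1)ᶜ

/-- The structure conditions on `A : [0, ∞) → ℝ`: continuity, `δ ≤ A ≤ L` with positive `δ, L`,
and `t ↦ t ^ (p - 1) * A t` strictly increasing for `t > 0`.  Only the values of `A` on `[0, ∞)`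
matter. -/
structure StructureConditions (p δ L : ℝ) (A : ℝ → ℝ) : Prop where
  continuousOn : ContinuousOn A (Ici 0)
  delta_pos : 0 < δ
  L_pos : 0 < L
  lower : ∀ t, 0 ≤ t → δ ≤ A t
  upper : ∀ t, 0 ≤ t → A t ≤ L
  strictMonoOn : StrictMonoOn (fun t : ℝ => t ^ (p - 1) * A t) (Ioi 0)

/-- Test functions: `η ∈ C_c^∞(Ω)`. -/
structure IsTestFunction {n : ℕ} (Ω : Set (E n)) (η : E n → ℝ) : Prop where
  contDiff : ContDiff ℝ ∞ η
  hasCompactSupport : HasCompactSupport η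
  tsupport_subset : tsupport η ⊆ Ω

/-- `G` is the weak gradient of `u` in the open set `Ω`: both are locally integrable in `Ω` and
`∫_Ω u ∂_v η = - ∫_Ω η (G · v)` for all test functions `η` and all directions `v`. -/
structure HasWeakGradient {n : ℕ} (Ω : Set (E n)) (u : E n → ℝ) (G : E n → E n) : Prop where
  locallyIntegrableOn : LocallyIntegrableOn u Ω
  locallyIntegrableOn_grad : LocallyIntegrableOn G Ω
  integral_eq : ∀ η : E n → ℝ, IsTestFunction Ω η → ∀ v : E n,
    ∫ x in Ω, u x * fderiv ℝ η x v = - ∫ x in Ω, η x * inner ℝ (G x) v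

/-- `g ∈ L^p_loc(Ω)`: `g` is in `L^p(K)` for every compact `K ⊆ Ω`. -/
def MemLpLoc {n : ℕ} {F : Type*} [NormedAddCommGroup F] (p : ℝ) (Ω : Set (E n)) (g : E n → F) :
    Prop :=
  ∀ K : Set (E n), IsCompact K → K ⊆ Ω → MemLp g (ENNReal.ofReal p) (volume.restrict K)

/-- `u ∈ W^{1,p}_loc(Ω)` with weak gradient `G`. -/
structure MemW1pLoc {n : ℕ} (p : ℝ) (Ω : Set (E n)) (u : E n → ℝ) (G : E n → E n) : Prop where
  hasWeakGradient : HasWeakGradient Ω u G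
  memLpLoc : MemLpLoc p Ω u
  memLpLoc_grad : MemLpLoc p Ω G

/-- `u ∈ W^{1,p}_loc(Ω)` is a weak solution of `-div (|∇u|^{p-2} A(|∇u|) ∇u) = f` in `Ω`:
`∫_Ω |∇u|^{p-2} A(|∇u|) ∇u · ∇η = ∫_Ω f η` for all `η ∈ C_c^∞(Ω)`. -/
def IsWeakSolution {n : ℕ} (p : ℝ) (A : ℝ → ℝ) (f : E n → ℝ) (Ω : Set (E n)) (u : E n → ℝ) :
    Prop :=
  ∃ G : E n → E n, MemW1pLoc p Ω u G ∧
    ∀ η : E n → ℝ, IsTestFunction Ω η →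
      ∫ x in Ω, ‖G x‖ ^ (p - 2) * A ‖G x‖ * inner ℝ (G x) (gradient η x)
        = ∫ x in Ω, f x * η x

/-- `m_R = inf_{S_R} u`. -/
noncomputable def sphereInf {n : ℕ} (u : E n → ℝ) (R : ℝ) : ℝ :=
  sInf (u '' Metric.sphere (0 : E n) R)

/-- `M_R = sup_{S_R} u`. -/
noncomputable def sphereSup {n : ℕ} (u : E n → ℝ) (R : ℝ) : ℝ :=
  sSup (u '' Metric.sphere (0 : E n) R)

/-- The constant `C₀ = (C_f / (δ (p - n + ε)))^{1/(p-1)} ((p - 1) / ε)`. -/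
noncomputable def C₀ (n : ℕ) (p δ Cf ε : ℝ) : ℝ :=
  (Cf / (δ * (p - n + ε))) ^ (1 / (p - 1)) * ((p - 1) / ε)

end ExteriorProblem

/-! The solution is compared with an explicit radial supersolution. Put `a ξ = |ξ|^(p-2) A(|ξ|) ξ`.
Since `t ^ (p - 1) * A t` has a continuous inverse, a radial `V` may be given any prescribed
positive flux. The choice `Φ r = c r^(-(p-1+ε)) + k r^(1-n)` makes `-div a(∇V) = C |x|^(-(p+ε))`:
the first term produces the source, the second is divergence free away from the origin. Because `p ≥
n`, the second term alone forces `V' ≥ const / r`, so `V` grows at least logarithmically, however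
small `k > 0` is. Since `A ≥ δ` and `1/(p-1) ≤ 1`, integrating `V'` bounds `V` by `C₀ R^(-ε/(p-1))`
plus a term that vanishes with `k` at each fixed point (`exists_barrier`).

As `u` is bounded and `V` is not, `u` can exceed `M + t + V` only on a compact subset of `{R <
|x|}`, so no condition at infinity is needed. There `le_of_strict_supersolution` applies:
subtracting the two equations and testing with a smooth truncation of the positive part of `u - M -
t - V` gives a nonpositive total, whereas monotonicity of `a` and the strict gap between the
right-hand sides make the integrand nonnegative. The truncation must therefore vanish. Only smooth
test functions are admissible, so `χ (u - V)` is mollified first and the limit is taken by a Fatou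
argument. Letting `t → 0` gives the upper bound; the lower one is the upper bound for `-u`. -/

namespace ExteriorProblem

open Filter Topology
open scoped Convolution

/-! ### Inversion, monotonicity and growth of the flux -/

section Flux

variable {p δ L : ℝ} {A : ℝ → ℝ}

/-- The scalar flux `t ↦ t ^ (p - 1) * A t` is monotone on `[0, ∞)`. -/
theorem StructureConditions.monotoneOn_flux (hA : StructureConditions p δ L A) (hp : 1 < p) :
    MonotoneOn (fun t : ℝ => t ^ (p - 1) * A t) (Ici 0) := by
  intro s hs t ht hst
  rcases (mem_Ici.1 hs).eq_or_lt with rfl | hs'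
  · have h := hA.lower t ht
    have := hA.delta_pos
    have h0 : (0 : ℝ) ^ (p - 1) = 0 := Real.zero_rpow (by linarith)
    simp only [h0, zero_mul]
    exact mul_nonneg (Real.rpow_nonneg ht _) (by linarith)
  · exact hA.strictMonoOn.monotoneOn hs' (hs'.trans_le hst) hst

/-- The scalar flux has a continuous right inverse on `[0, ∞)`. -/
theorem StructureConditions.exists_flux_inverse (hA : StructureConditions p δ L A) (hp : 1 < p) :
    ∃ ψ : ℝ → ℝ, Continuous ψ ∧ ∀ s, 0 ≤ s → 0 ≤ ψ s ∧ ψ s ^ (p - 1) * A (ψ s) = s := by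
  have hp1 : 0 < p - 1 := by linarith
  have h0 : (0 : ℝ) ^ (p - 1) = 0 := Real.zero_rpow hp1.ne'
  -- Extending the flux by the identity on the negative axis gives a strictly increasing continuous
  -- bijection of the line, whose order inverse is automatically continuous.
  set F : ℝ → ℝ := fun t => min t 0 + (max t 0) ^ (p - 1) * A (max t 0) with hF
  have hFneg : ∀ t, t ≤ 0 → F t = t := fun t ht => by simp [hF, ht, h0]
  have hFpos : ∀ t, 0 ≤ t → F t = t ^ (p - 1) * A t := fun t ht => by simp [hF, ht]
  have hpos : ∀ t, 0 < t → 0 < F t := fun t ht => by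
    rw [hFpos t ht.le]
    exact mul_pos (Real.rpow_pos_of_pos ht _) (hA.delta_pos.trans_le (hA.lower t ht.le))
  have hmono : StrictMono F := by
    intro s t hst
    rcases le_or_gt t 0 with ht | ht
    · rw [hFneg t ht, hFneg s (by linarith)]; exact hst
    · rcases le_or_gt s 0 with hs | hs
      · rw [hFneg s hs]; exact hs.trans_lt (hpos t ht)
      · rw [hFpos s hs.le, hFpos t ht.le]; exact hA.strictMonoOn hs ht hst
  have hcont : Continuous F := by
    have hAc : Continuous fun t => A (max t 0) :=
      hA.continuousOn.comp_continuous (by fun_prop) fun t => mem_Ici.2 (le_max_right _ _)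
    have : Continuous fun t : ℝ => (max t 0) ^ (p - 1) :=
      (continuous_id.max continuous_const).rpow_const fun _ => Or.inr hp1.le
    exact (continuous_id.min continuous_const).add (this.mul hAc)
  have htop : Tendsto F atTop atTop := by
    have h1 : Tendsto (fun t : ℝ => t ^ (p - 1) * δ) atTop atTop :=
      (tendsto_rpow_atTop hp1).atTop_mul_const hA.delta_pos
    refine tendsto_atTop_mono' _ ?_ h1
    filter_upwards [eventually_ge_atTop 0] with t ht
    rw [hFpos t ht]
    exact mul_le_mul_of_nonneg_left (hA.lower t ht) (Real.rpow_nonneg ht _)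
  have hbot : Tendsto F atBot atBot := by
    refine tendsto_id.congr' ?_
    filter_upwards [eventually_le_atBot 0] with t ht
    exact (hFneg t ht).symm
  have hsurj : Function.Surjective F := hcont.surjective htop hbot
  set e := hmono.orderIsoOfSurjective F hsurj
  have he : ∀ s, F (e.symm s) = s := fun s =>
    hmono.orderIsoOfSurjective_self_symm_apply F hsurj s
  refine ⟨e.symm, e.symm.continuous, fun s hs => ?_⟩
  have hn : 0 ≤ e.symm s := by
    by_contra! h
    have := he s
    rw [hFneg _ h.le] at this
    linarith
  exact ⟨hn, by rw [← hFpos _ hn, he]⟩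

/-- Bounds for a solution of `t ^ (p - 1) * A t = s`. -/
theorem StructureConditions.flux_inverse_bounds (hA : StructureConditions p δ L A) (hp : 1 < p)
    {s t : ℝ} (ht : 0 ≤ t) (hs : t ^ (p - 1) * A t = s) :
    (s / L) ^ (1 / (p - 1)) ≤ t ∧ t ≤ (s / δ) ^ (1 / (p - 1)) := by
  have hp1 : 0 < p - 1 := by linarith
  have hL := hA.L_pos
  have hδ := hA.delta_pos
  have htp : 0 ≤ t ^ (p - 1) := Real.rpow_nonneg ht _
  have e : (t ^ (p - 1)) ^ (1 / (p - 1)) = t := by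
    rw [← Real.rpow_mul ht, mul_one_div_cancel hp1.ne', Real.rpow_one]
  have hs0 : 0 ≤ s := hs ▸ mul_nonneg htp (hδ.le.trans (hA.lower t ht))
  have hq : 0 ≤ 1 / (p - 1) := by positivity
  constructor
  · conv_rhs => rw [← e]
    refine Real.rpow_le_rpow (by positivity) ?_ hq
    rw [div_le_iff₀ hL, ← hs]
    exact mul_le_mul_of_nonneg_left (hA.upper t ht) htp
  · conv_lhs => rw [← e]
    refine Real.rpow_le_rpow htp ?_ hq
    rw [le_div_iff₀ hδ, ← hs]
    exact mul_le_mul_of_nonneg_left (hA.lower t ht) htp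

/-- Monotonicity of the vector field `ξ ↦ |ξ| ^ (p - 2) * A |ξ| * ξ`. -/
theorem StructureConditions.inner_field_sub_nonneg {V : Type*} [NormedAddCommGroup V]
    [InnerProductSpace ℝ V] (hA : StructureConditions p δ L A) (hp : 2 ≤ p) (ξ ζ : V) :
    0 ≤ inner ℝ ((‖ξ‖ ^ (p - 2) * A ‖ξ‖) • ξ - (‖ζ‖ ^ (p - 2) * A ‖ζ‖) • ζ) (ξ - ζ) := by
  have key : ∀ s : ℝ, 0 ≤ s → s ^ (p - 2) * A s * s = s ^ (p - 1) * A s := fun s hs => by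
    have : s ^ (p - 1) = s ^ (p - 2) * s := by
      rcases hs.eq_or_lt with rfl | hs
      · rw [Real.zero_rpow (by linarith), mul_zero]
      · rw [← Real.rpow_add_one hs.ne']; congr 1; ring
    rw [this]; ring
  have hc : ∀ s : ℝ, 0 ≤ s → 0 ≤ s ^ (p - 2) * A s := fun s hs =>
    mul_nonneg (Real.rpow_nonneg hs _) (hA.delta_pos.le.trans (hA.lower s hs))
  have hm : 0 ≤ (‖ξ‖ ^ (p - 1) * A ‖ξ‖ - ‖ζ‖ ^ (p - 1) * A ‖ζ‖) * (‖ξ‖ - ‖ζ‖) := by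
    rcases le_total ‖ζ‖ ‖ξ‖ with h | h
    · exact mul_nonneg (sub_nonneg.2 (hA.monotoneOn_flux (by linarith)
        (norm_nonneg ζ) (norm_nonneg ξ) h)) (sub_nonneg.2 h)
    · exact mul_nonneg_of_nonpos_of_nonpos (sub_nonpos.2 (hA.monotoneOn_flux (by linarith)
        (norm_nonneg ξ) (norm_nonneg ζ) h)) (sub_nonpos.2 h)
  rw [← key _ (norm_nonneg ξ), ← key _ (norm_nonneg ζ)] at hm
  have h1 := hc _ (norm_nonneg ξ)
  have h2 := hc _ (norm_nonneg ζ)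
  set α := ‖ξ‖ ^ (p - 2) * A ‖ξ‖
  set β := ‖ζ‖ ^ (p - 2) * A ‖ζ‖
  have hin := real_inner_le_norm ξ ζ
  have e : inner ℝ (α • ξ - β • ζ) (ξ - ζ)
      = α * ‖ξ‖ ^ 2 + β * ‖ζ‖ ^ 2 - (α + β) * inner ℝ ξ ζ := by
    simp only [inner_sub_left, inner_sub_right, inner_smul_left, real_inner_self_eq_norm_sq,
      real_inner_comm ξ ζ, conj_trivial]
    ring
  rw [e]
  -- By Cauchy–Schwarz the expression is at least `(α‖ξ‖ - β‖ζ‖)(‖ξ‖ - ‖ζ‖)`, which is the scalar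
  -- product `hm`.
  nlinarith [mul_le_mul_of_nonneg_left hin (add_nonneg h1 h2)]

/-- Growth of the vector field `ξ ↦ |ξ| ^ (p - 2) * A |ξ| * ξ`. -/
theorem StructureConditions.norm_field_le {V : Type*} [NormedAddCommGroup V]
    [NormedSpace ℝ V] (hA : StructureConditions p δ L A) (hp : 2 ≤ p) (ξ : V) :
    ‖(‖ξ‖ ^ (p - 2) * A ‖ξ‖) • ξ‖ ≤ L * ‖ξ‖ ^ (p - 1) := by
  have h1 : ‖ξ‖ ^ (p - 2) * ‖ξ‖ = ‖ξ‖ ^ (p - 1) := by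
    rcases (norm_nonneg ξ).eq_or_lt with h | h
    · rw [← h, Real.zero_rpow (x := p - 1) (by linarith), mul_zero]
    · rw [← Real.rpow_add_one h.ne']; congr 1; ring
  have h2 : 0 ≤ A ‖ξ‖ := hA.delta_pos.le.trans (hA.lower _ (norm_nonneg _))
  have h3 : 0 ≤ ‖ξ‖ ^ (p - 2) := Real.rpow_nonneg (norm_nonneg _) _
  rw [norm_smul, Real.norm_of_nonneg (mul_nonneg h3 h2), ← h1]
  have := mul_le_mul_of_nonneg_left (hA.upper _ (norm_nonneg ξ))
    (mul_nonneg h3 (norm_nonneg ξ))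
  linarith

/-- The vector field `ξ ↦ |ξ| ^ (p - 2) * A |ξ| * ξ` is continuous. -/
theorem StructureConditions.continuous_field {V : Type*} [NormedAddCommGroup V]
    [NormedSpace ℝ V] (hA : StructureConditions p δ L A) (hp : 2 ≤ p) :
    Continuous fun ξ : V => (‖ξ‖ ^ (p - 2) * A ‖ξ‖) • ξ := by
  have h1 : Continuous fun ξ : V => A ‖ξ‖ :=
    hA.continuousOn.comp_continuous continuous_norm fun ξ => norm_nonneg ξ
  have h2 : Continuous fun ξ : V => ‖ξ‖ ^ (p - 2) :=
    continuous_norm.rpow_const fun _ => Or.inr (by linarith)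
  exact (h2.mul h1).smul continuous_id

end Flux

/-! ### Young inequality and a Fatou argument -/

/-- A weighted Young inequality without constants. -/
theorem rpow_sub_one_mul_le {p s t : ℝ} (hp : 1 ≤ p) (hs : 0 ≤ s) (ht : 0 ≤ t) :
    s ^ (p - 1) * t ≤ s ^ p + t ^ p := by
  have key : ∀ r : ℝ, 0 ≤ r → r ^ (p - 1) * r = r ^ p := fun r hr => by
    rcases hr.eq_or_lt with rfl | h
    · rw [mul_zero, Real.zero_rpow (by linarith)]
    · rw [← Real.rpow_add_one h.ne']; congr 1; ring
  have hs' := Real.rpow_nonneg hs p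
  have ht' := Real.rpow_nonneg ht p
  rcases le_total s t with h | h
  · have := mul_le_mul_of_nonneg_right (Real.rpow_le_rpow hs h (by linarith : 0 ≤ p - 1)) ht
    rw [key t ht] at this
    linarith
  · have := mul_le_mul_of_nonneg_left h (Real.rpow_nonneg hs (p - 1))
    rw [key s hs] at this
    linarith

/-- A Fatou-type argument: if `D j + H j ≥ 0`, the integrals of `D j` are nonpositive, those of
`H j` are at most that of their limit, and the limit of `D j` is nonnegative, then the limit of
`D j` vanishes. -/
theorem ae_eq_zero_of_integral_nonpos_of_tendsto {α : Type*} [MeasurableSpace α] {μ : Measure α}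
    {D H : ℕ → α → ℝ} {d h : α → ℝ}
    (hD : ∀ j, Integrable (D j) μ) (hH : ∀ j, Integrable (H j) μ) (hh : Integrable h μ)
    (hdm : AEMeasurable d μ)
    (hle : ∀ j, 0 ≤ᵐ[μ] D j + H j) (hDint : ∀ j, ∫ x, D j x ∂μ ≤ 0)
    (hHint : ∀ j, ∫ x, H j x ∂μ ≤ ∫ x, h x ∂μ)
    (hDlim : ∀ᵐ x ∂μ, Tendsto (fun j => D j x) atTop (𝓝 (d x)))
    (hHlim : ∀ᵐ x ∂μ, Tendsto (fun j => H j x) atTop (𝓝 (h x)))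
    (hd : 0 ≤ᵐ[μ] d) (hh0 : 0 ≤ᵐ[μ] h) : d =ᵐ[μ] 0 := by
  -- Fatou for the nonnegative `D j + H j` will give `∫ d + ∫ h ≤ ∫ h`; the finite `∫ h` then
  -- cancels.
  have h1 : ∫⁻ x, ENNReal.ofReal (d x + h x) ∂μ
      ≤ liminf (fun j => ∫⁻ x, ENNReal.ofReal (D j x + H j x) ∂μ) atTop := by
    refine le_trans (le_of_eq ?_) (lintegral_liminf_le' fun j => ?_)
    · refine lintegral_congr_ae ?_
      filter_upwards [hDlim, hHlim] with x hx hx'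
      exact ((ENNReal.continuous_ofReal.tendsto _).comp (hx.add hx')).liminf_eq.symm
    · exact ((hD j).add (hH j)).aemeasurable.ennreal_ofReal
  have h2 : ∀ j, ∫⁻ x, ENNReal.ofReal (D j x + H j x) ∂μ ≤ ENNReal.ofReal (∫ x, h x ∂μ) := by
    intro j
    refine (ofReal_integral_eq_lintegral_ofReal ((hD j).add (hH j)) (hle j)).symm.trans_le ?_
    refine ENNReal.ofReal_le_ofReal ?_
    refine (integral_add (hD j) (hH j)).trans_le ?_
    linarith [hDint j, hHint j]
  have h3 : ∫⁻ x, ENNReal.ofReal (d x + h x) ∂μ ≤ ENNReal.ofReal (∫ x, h x ∂μ) :=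
    h1.trans (liminf_le_of_le (by isBoundedDefault) fun b hb => by
      obtain ⟨j, hj⟩ := hb.exists
      exact hj.trans (h2 j))
  have h4 : ∫⁻ x, ENNReal.ofReal (d x + h x) ∂μ
      = ∫⁻ x, ENNReal.ofReal (d x) ∂μ + ∫⁻ x, ENNReal.ofReal (h x) ∂μ := by
    rw [← lintegral_add_left' hdm.ennreal_ofReal]
    refine lintegral_congr_ae ?_
    filter_upwards [hd, hh0] with x hx hx'
    exact ENNReal.ofReal_add hx hx'
  rw [h4, ofReal_integral_eq_lintegral_ofReal hh hh0] at h3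
  have h5 : ∫⁻ x, ENNReal.ofReal (h x) ∂μ ≠ ⊤ := by
    rw [← ofReal_integral_eq_lintegral_ofReal hh hh0]; exact ENNReal.ofReal_ne_top
  have h6 : ∫⁻ x, ENNReal.ofReal (d x) ∂μ = 0 := by
    by_contra hne
    refine absurd h3 (not_le.2 ?_)
    rw [add_comm]
    exact ENNReal.lt_add_right h5 hne
  have h7 := (lintegral_eq_zero_iff' hdm.ennreal_ofReal).1 h6
  filter_upwards [h7, hd] with x hx hx'
  exact le_antisymm (ENNReal.ofReal_eq_zero.1 hx) hx'

/-! ### Integration by parts and divergences of power fields -/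

theorem integrable_mul_of_isCompact_tsupport {n : ℕ} {Ω : Set (E n)} {g η : E n → ℝ}
    (hg : LocallyIntegrableOn g Ω) (hη : Continuous η) (hc : HasCompactSupport η)
    (hs : tsupport η ⊆ Ω) : Integrable fun x => g x * η x := by
  have h1 : IntegrableOn (fun x => g x * η x) (tsupport η) :=
    (hg.integrableOn_compact_subset hs hc).mul_continuousOn hη.continuousOn hc
  refine (integrableOn_iff_integrable_of_support_subset ?_).1 h1
  intro x hx
  exact subset_tsupport _ (right_ne_zero_of_mul hx)

theorem IsTestFunction.continuous_fderiv_apply {n : ℕ} {Ω : Set (E n)} {η : E n → ℝ}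
    (h : IsTestFunction Ω η) (v : E n) : Continuous fun x => fderiv ℝ η x v :=
  (h.contDiff.continuous_fderiv (by simp)).clm_apply continuous_const

theorem inner_gradient_eq_fderiv {n : ℕ} (η : E n → ℝ) (x v : E n) :
    inner ℝ v (gradient η x) = fderiv ℝ η x v := by
  rw [real_inner_comm]
  simp [gradient]

/-- Integration by parts against a test function supported where `V` is `C¹`. -/
theorem integral_mul_fderiv_of_hasGradientAt {n : ℕ} {Ω : Set (E n)} (hΩ : IsOpen Ω)
    {V : E n → ℝ} {H : E n → E n}
    (hV : ∀ x ∈ Ω, HasGradientAt V (H x) x) (hH : ContinuousOn H Ω) {η : E n → ℝ}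
    (hη : IsTestFunction Ω η) (v : E n) :
    ∫ x, V x * fderiv ℝ η x v = - ∫ x, η x * inner ℝ (H x) v := by
  have hVc : ContinuousOn V Ω := fun x hx => (hV x hx).continuousAt.continuousWithinAt
  have hs : tsupport (fun x => fderiv ℝ η x v) ⊆ tsupport η := tsupport_fderiv_apply_subset ℝ v
  have hHv : ContinuousOn (fun x => inner ℝ (H x) v) Ω := hH.inner continuousOn_const
  have hmeas : MeasurableSet Ω := hΩ.measurableSet
  have e : ∀ x, InnerProductSpace.toDual ℝ (E n) (H x) v = inner ℝ (H x) v := fun x => by simp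
  have := integral_bilinear_hasFDerivAt_right_eq_neg_left_of_integrable (μ := volume)
    (f := V) (f' := fun x => InnerProductSpace.toDual ℝ (E n) (H x)) (g := η)
    (g' := fderiv ℝ η) (v := v) (B := ContinuousLinearMap.mul ℝ ℝ) ?_ ?_ ?_
    (fun x hx => (hV x (hη.tsupport_subset hx)).hasFDerivAt)
    (fun x _ => (hη.contDiff.differentiable (by simp) x).hasFDerivAt)
  · simpa only [ContinuousLinearMap.mul_apply', e, mul_comm (η _)] using this
  · simp only [ContinuousLinearMap.mul_apply', e]
    exact integrable_mul_of_isCompact_tsupport (hHv.locallyIntegrableOn hmeas)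
      hη.contDiff.continuous hη.hasCompactSupport hη.tsupport_subset
  · exact integrable_mul_of_isCompact_tsupport (hVc.locallyIntegrableOn hmeas)
      (hη.continuous_fderiv_apply v) (hη.hasCompactSupport.fderiv_apply ℝ v)
      (hs.trans hη.tsupport_subset)
  · exact integrable_mul_of_isCompact_tsupport (hVc.locallyIntegrableOn hmeas)
      hη.contDiff.continuous hη.hasCompactSupport hη.tsupport_subset

/-- The divergence of the identity vector field is the dimension. -/
theorem integral_fderiv_self {n : ℕ} {ψ : E n → ℝ} (hψ : IsTestFunction univ ψ) :
    ∫ x, fderiv ℝ ψ x x = - (n * ∫ x, ψ x) := by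
  have e : ∀ x : E n, fderiv ℝ ψ x x
      = ∑ i, x i * fderiv ℝ ψ x (EuclideanSpace.basisFun (Fin n) ℝ i) := fun x => by
    have h : x = ∑ i, x i • EuclideanSpace.basisFun (Fin n) ℝ i := by
      simpa using ((EuclideanSpace.basisFun (Fin n) ℝ).sum_repr x).symm
    have := congrArg (fderiv ℝ ψ x) h
    simpa only [map_sum, map_smul, smul_eq_mul] using this
  have hgrad : ∀ i : Fin n, ∀ x : E n, HasGradientAt (fun x : E n => x i)
      (EuclideanSpace.basisFun (Fin n) ℝ i) x := fun i x => by
    rw [hasGradientAt_iff_hasFDerivAt]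
    convert! (EuclideanSpace.proj (𝕜 := ℝ) i : E n →L[ℝ] ℝ).hasFDerivAt using 1
    ext y
    simp [EuclideanSpace.inner_single_left]
  have hi : ∀ i : Fin n, ∫ x : E n, x i * fderiv ℝ ψ x (EuclideanSpace.basisFun (Fin n) ℝ i)
      = - ∫ x, ψ x := fun i => by
    rw [integral_mul_fderiv_of_hasGradientAt isOpen_univ (fun x _ => hgrad i x)
      continuousOn_const hψ]
    simp
  simp_rw [e]
  rw [integral_finsetSum]
  · simp_rw [hi]
    simp
  · intro i _
    exact integrable_mul_of_isCompact_tsupport (Ω := univ)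
      ((by fun_prop : Continuous fun x : E n => x i).continuousOn.locallyIntegrableOn
        MeasurableSet.univ)
      (hψ.continuous_fderiv_apply _) (hψ.hasCompactSupport.fderiv_apply ℝ _) (subset_univ _)

theorem isOpen_norm_gt {n : ℕ} (R : ℝ) : IsOpen {x : E n | R < ‖x‖} :=
  isOpen_lt continuous_const continuous_norm

theorem continuousOn_norm_rpow {n : ℕ} {R : ℝ} (hR : 0 ≤ R) (a : ℝ) :
    ContinuousOn (fun x : E n => ‖x‖ ^ a) {x : E n | R < ‖x‖} :=
  continuous_norm.continuousOn.rpow_const fun _ hx => Or.inl (hR.trans_lt hx).ne'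

/-- The divergence of `|x| ^ a x` is `(n + a) |x| ^ a`. -/
theorem integral_norm_rpow_mul_inner_gradient {n : ℕ} {R : ℝ} (hR : 0 ≤ R) (a : ℝ) {η : E n → ℝ}
    (hη : IsTestFunction {x : E n | R < ‖x‖} η) :
    ∫ x, ‖x‖ ^ a * inner ℝ x (gradient η x) = - ((n + a) * ∫ x, ‖x‖ ^ a * η x) := by
  have h0 : ∀ x ∈ tsupport η, x ≠ 0 := fun x hx h => by
    have := hη.tsupport_subset hx
    rw [mem_ofPred_eq, h, norm_zero] at this
    linarith
  have hnd : ∀ x : E n, x ≠ 0 → ContDiffAt ℝ ∞ (fun x : E n => ‖x‖ ^ a) x := fun x hx =>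
    (contDiffAt_norm ℝ hx).rpow_const_of_ne (norm_ne_zero_iff.2 hx)
  have hts : tsupport (fun x => ‖x‖ ^ a * η x) ⊆ tsupport η :=
    closure_mono fun x hx => right_ne_zero_of_mul hx
  -- The support of `η` avoids the origin, so `‖x‖ ^ a * η` is smooth on the whole space and
  -- `integral_fderiv_self` applies to it.
  have hψ : IsTestFunction univ (fun x : E n => ‖x‖ ^ a * η x) := by
    refine ⟨contDiff_iff_contDiffAt.2 fun x => ?_, hη.hasCompactSupport.mul_left, subset_univ _⟩
    by_cases hx : x ∈ tsupport η
    · exact (hnd x (h0 x hx)).mul hη.contDiff.contDiffAt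
    · have : (fun x : E n => ‖x‖ ^ a * η x) =ᶠ[𝓝 x] fun _ => 0 := by
        filter_upwards [(isClosed_tsupport η).isOpen_compl.mem_nhds hx] with y hy
        rw [image_eq_zero_of_notMem_tsupport hy, mul_zero]
      exact contDiffAt_const.congr_of_eventuallyEq this
  have e : ∀ x : E n, fderiv ℝ (fun x : E n => ‖x‖ ^ a * η x) x x
      = ‖x‖ ^ a * inner ℝ x (gradient η x) + a * (‖x‖ ^ a * η x) := by
    intro x
    by_cases hx : x ∈ tsupport η
    · have hx0 := h0 x hx
      have hxn : ‖x‖ ≠ 0 := norm_ne_zero_iff.2 hx0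
      -- Euler's identity for a homogeneous function, by differentiating along the ray `t • x` at `t
      -- = 1`.
      have h1 : fderiv ℝ (fun x : E n => ‖x‖ ^ a) x x = a * ‖x‖ ^ a := by
        have hd : HasDerivAt (fun t : ℝ => ‖t • x‖ ^ a) (fderiv ℝ (fun x : E n => ‖x‖ ^ a) x x) 1 := by
          have h2 : HasDerivAt (fun t : ℝ => t • x) x 1 := by
            simpa using (hasDerivAt_id (1 : ℝ)).smul_const x
          have h3 : HasFDerivAt (fun x : E n => ‖x‖ ^ a) (fderiv ℝ (fun x : E n => ‖x‖ ^ a) x)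
              ((1 : ℝ) • x) := by
            rw [one_smul]
            exact ((hnd x hx0).differentiableAt (by simp)).hasFDerivAt
          exact h3.comp_hasDerivAt 1 h2
        have hd' : HasDerivAt (fun t : ℝ => ‖t • x‖ ^ a) (a * ‖x‖ ^ a) 1 := by
          have h4 : HasDerivAt (fun t : ℝ => t ^ a * ‖x‖ ^ a) (a * ‖x‖ ^ a) 1 := by
            simpa using ((Real.hasDerivAt_rpow_const (p := a) (Or.inl one_ne_zero)).mul_const
              (‖x‖ ^ a))
          refine h4.congr_of_eventuallyEq ?_
          filter_upwards [lt_mem_nhds one_pos] with t ht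
          rw [norm_smul, Real.norm_of_nonneg (le_of_lt ht),
            Real.mul_rpow (le_of_lt ht) (norm_nonneg _)]
        exact hd.unique hd'
      rw [fderiv_fun_mul ((hnd x hx0).differentiableAt (by simp))
        (hη.contDiff.differentiable (by simp) x)]
      simp only [_root_.add_apply, _root_.smul_apply, smul_eq_mul, h1,
        inner_gradient_eq_fderiv]
      ring
    · have h1 : fderiv ℝ (fun x : E n => ‖x‖ ^ a * η x) x = 0 :=
        image_eq_zero_of_notMem_tsupport fun h => hx (hts (tsupport_fderiv_subset ℝ h))
      have h2 : fderiv ℝ η x = 0 :=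
        image_eq_zero_of_notMem_tsupport fun h => hx (tsupport_fderiv_subset ℝ h)
      rw [inner_gradient_eq_fderiv, h1, h2, image_eq_zero_of_notMem_tsupport hx]
      simp
  have hli := (continuousOn_norm_rpow (n := n) hR a).locallyIntegrableOn
    (isOpen_norm_gt R).measurableSet (μ := volume)
  have hi1 : Integrable fun x : E n => ‖x‖ ^ a * η x :=
    integrable_mul_of_isCompact_tsupport hli hη.contDiff.continuous hη.hasCompactSupport
      hη.tsupport_subset
  have hs : tsupport (fun x => fderiv ℝ η x x) ⊆ tsupport η :=
    (closure_mono fun x hx => Function.mem_support.2 fun h => Function.mem_support.1 hx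
      (by simp [h])).trans (tsupport_fderiv_subset ℝ (f := η))
  have hi2 : Integrable fun x : E n => ‖x‖ ^ a * inner ℝ x (gradient η x) := by
    simp_rw [inner_gradient_eq_fderiv]
    exact integrable_mul_of_isCompact_tsupport hli
      ((hη.contDiff.continuous_fderiv (by simp)).clm_apply continuous_id)
      (hη.hasCompactSupport.of_isClosed_subset (isClosed_tsupport _) hs)
      (hs.trans hη.tsupport_subset)
  have := integral_fderiv_self hψ
  simp_rw [e] at this
  rw [integral_add hi2 (hi1.const_mul a), integral_const_mul] at this
  linarith

/-! ### The radial barrier -/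

/-- A radial function with derivative `g ‖x‖`. -/
theorem hasGradientAt_radial_integral {n : ℕ} {g : ℝ → ℝ} (hg : Continuous g) (R : ℝ) {x : E n}
    (hx : x ≠ 0) :
    HasGradientAt (fun x : E n => ∫ s in R..‖x‖, g s) ((g ‖x‖ * ‖x‖⁻¹) • x) x := by
  have h1 : HasDerivAt (fun r => ∫ s in R..r, g s) (g ‖x‖) ‖x‖ :=
    (hg.integral_hasStrictDerivAt R ‖x‖).hasDerivAt
  have h2 : HasFDerivAt (fun x : E n => ‖x‖) (InnerProductSpace.toDual ℝ (E n) (‖x‖⁻¹ • x)) x := by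
    have hd : DifferentiableAt ℝ (fun x : E n => ‖x‖) x :=
      (contDiffAt_norm ℝ (n := 1) hx).differentiableAt (by simp)
    -- The gradient of the norm is identified by computing the derivative of `‖y‖ ^ 2` in two ways.
    have hs : HasFDerivAt (fun y : E n => ‖y‖ ^ 2) (2 • innerSL ℝ x) x :=
      (hasStrictFDerivAt_norm_sq x).hasFDerivAt
    have hs' := hd.hasFDerivAt.pow 2
    have := hs'.unique hs
    have hxn : ‖x‖ ≠ 0 := norm_ne_zero_iff.2 hx
    convert! hd.hasFDerivAt using 1
    ext v
    have hv := DFunLike.congr_fun this v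
    simp at hv
    simp
    field_simp
    linarith
  rw [hasGradientAt_iff_hasFDerivAt]
  convert! h1.comp_hasFDerivAt x h2 using 1
  ext v
  simp
  ring

/-- The radial supersolution `V` with `-div a(∇V) = C |x| ^ (-(p + ε))`, vanishing on the sphere of
radius `R`, unbounded at infinity, with explicit bounds. -/
theorem StructureConditions.exists_barrier {n : ℕ} (hn : 2 ≤ n) {p : ℝ} (hp : (n : ℝ) ≤ p)
    {A : ℝ → ℝ} {δ L : ℝ} (hA : StructureConditions p δ L A) {C ε k R : ℝ} (hC : 0 < C)
    (hε : 0 < ε) (hk : 0 < k) (hR : 1 ≤ R) :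
    ∃ (V : E n → ℝ) (H : E n → E n),
      Continuous V ∧
      (∀ x, R < ‖x‖ → HasGradientAt V (H x) x) ∧ ContinuousOn H {x | R < ‖x‖} ∧
      (∀ η, IsTestFunction {x : E n | R < ‖x‖} η →
        ∫ x, inner ℝ ((‖H x‖ ^ (p - 2) * A ‖H x‖) • H x) (gradient η x)
          = ∫ x, (C * ‖x‖ ^ (-(p + ε))) * η x) ∧
      (∀ B, ∃ ρ, ∀ x, R ≤ ‖x‖ → ρ ≤ ‖x‖ → B < V x) ∧
      (∀ x, R ≤ ‖x‖ → 0 ≤ V x) ∧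
      (∀ x, R ≤ ‖x‖ →
        V x ≤ C₀ n p δ C ε * R ^ (-(ε / (p - 1))) + (k / δ) ^ (1 / (p - 1)) * (‖x‖ - R)) := by
  have hn' : (2 : ℝ) ≤ n := by exact_mod_cast hn
  have hp2 : 2 ≤ p := hn'.trans hp
  have hp1 : 1 < p := by linarith
  have hδ := hA.delta_pos
  have hL := hA.L_pos
  obtain ⟨ψ, hψc, hψ⟩ := hA.exists_flux_inverse hp1
  set q : ℝ := 1 / (p - 1) with hq
  have hq0 : 0 < q := by rw [hq]; exact one_div_pos.2 (by linarith)
  have hq1 : q ≤ 1 := by rw [hq, div_le_one (by linarith)]; linarith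
  have hqp : (p - 1) * q = 1 := by rw [hq]; exact mul_one_div_cancel (by linarith)
  -- The divergence of `|x|^(-(p+ε)) x` is `-(p - n + ε) |x|^(-(p+ε))`; this `c` normalizes the
  -- source to `C`.
  set c : ℝ := C / (p - n + ε) with hc
  have hpn : 0 < p - n + ε := by linarith
  have hc0 : 0 < c := by positivity
  set Φ : ℝ → ℝ := fun r => c * r ^ (-(p - 1 + ε)) + k * r ^ (1 - (n : ℝ)) with hΦ
  have hΦpos : ∀ r, 0 < r → 0 < Φ r := fun r hr => by positivity
  -- The cutoff at `1` makes `g` continuous on the whole line; only radii at least `R ≥ 1` matter.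
  set g : ℝ → ℝ := fun r => ψ (Φ (max r 1)) with hg
  have hm : ∀ r : ℝ, max r 1 ≠ 0 := fun r => (lt_of_lt_of_le one_pos (le_max_right r 1)).ne'
  have hgc : Continuous g := by
    have h1 : Continuous fun r : ℝ => max r 1 := continuous_id.max continuous_const
    refine hψc.comp (((h1.rpow_const fun r => Or.inl (hm r)).const_mul c).add
      ((h1.rpow_const fun r => Or.inl (hm r)).const_mul k))
  have hg1 : ∀ r, 1 ≤ r → 0 ≤ g r ∧ g r ^ (p - 1) * A (g r) = Φ r := fun r hr => by
    simp only [hg, max_eq_left hr]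
    exact hψ _ (hΦpos r (by linarith)).le
  have hpos : ∀ r : ℝ, 1 ≤ r → 0 < r := fun r hr => by linarith
  -- Here `p ≥ n` enters: `(n - 1)/(p - 1) ≤ 1`, so the slope decays no faster than `1/r`.
  have hglow : ∀ r, 1 ≤ r → (k / L) ^ q * r⁻¹ ≤ g r := fun r hr => by
    have hr0 := hpos r hr
    refine le_trans ?_ (hA.flux_inverse_bounds hp1 (hg1 r hr).1 (hg1 r hr).2).1
    have h1 : r⁻¹ ≤ (r ^ (1 - (n : ℝ))) ^ q := by
      rw [← Real.rpow_mul hr0.le, ← Real.rpow_neg_one]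
      refine Real.rpow_le_rpow_of_exponent_le hr ?_
      have : ((n : ℝ) - 1) * q ≤ (p - 1) * q := by gcongr
      linarith
    calc (k / L) ^ q * r⁻¹ ≤ (k / L) ^ q * (r ^ (1 - (n : ℝ))) ^ q := by gcongr
      _ = (k * r ^ (1 - (n : ℝ)) / L) ^ q := by
        rw [← Real.mul_rpow (by positivity) (by positivity)]; congr 1; ring
      _ ≤ (Φ r / L) ^ q := by
        gcongr
        have : 0 < c * r ^ (-(p - 1 + ε)) := by positivity
        simp only [hΦ]; linarith
  -- Since `q ≤ 1`, the power `q` is subadditive and the two parts of the flux separate.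
  have hgup : ∀ r, 1 ≤ r → g r ≤ (c / δ) ^ q * r ^ (-(1 + ε * q)) + (k / δ) ^ q := fun r hr => by
    have hr0 := hpos r hr
    refine (hA.flux_inverse_bounds hp1 (hg1 r hr).1 (hg1 r hr).2).2.trans ?_
    have h1 : r ^ (1 - (n : ℝ)) ≤ 1 := Real.rpow_le_one_of_one_le_of_nonpos hr (by linarith)
    calc (Φ r / δ) ^ q ≤ (c / δ * r ^ (-(p - 1 + ε)) + k / δ) ^ q := by
          refine Real.rpow_le_rpow (div_nonneg (hΦpos r hr0).le hδ.le) ?_ hq0.le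
          have : k * r ^ (1 - (n : ℝ)) / δ ≤ k / δ := by
            gcongr; nlinarith
          simp only [hΦ, add_div]
          have e : c * r ^ (-(p - 1 + ε)) / δ = c / δ * r ^ (-(p - 1 + ε)) := by ring
          linarith
      _ ≤ (c / δ * r ^ (-(p - 1 + ε))) ^ q + (k / δ) ^ q :=
          Real.rpow_add_le_add_rpow (by positivity) (by positivity) hq0.le hq1
      _ = _ := by
          rw [Real.mul_rpow (by positivity) (by positivity), ← Real.rpow_mul hr0.le]
          congr 3
          linarith
  have hint : ∀ (f : ℝ → ℝ) (r : ℝ), R ≤ r → ContinuousOn f (Ici 1) →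
      IntervalIntegrable f volume R r := fun f r hr hf =>
    (hf.mono (by rw [uIcc_of_le hr]; exact fun s hs => hR.trans hs.1)).intervalIntegrable
  have hgi : ∀ r, IntervalIntegrable g volume R r := fun r => hgc.intervalIntegrable _ _
  have hnorm : ∀ x : E n, R < ‖x‖ → ‖(g ‖x‖ * ‖x‖⁻¹) • x‖ = g ‖x‖ := fun x hx => by
    have h0 : 0 < ‖x‖ := by linarith
    rw [norm_smul, Real.norm_of_nonneg (mul_nonneg (hg1 _ (hR.trans hx.le)).1 (by positivity)),
      mul_assoc, inv_mul_cancel₀ h0.ne', mul_one]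
  refine ⟨fun x => ∫ s in R..‖x‖, g s, fun x => (g ‖x‖ * ‖x‖⁻¹) • x, ?_, ?_, ?_, ?_, ?_, ?_, ?_⟩
  · exact (intervalIntegral.continuous_primitive (fun a b => hgc.intervalIntegrable a b) R).comp
      continuous_norm
  · intro x hx
    refine hasGradientAt_radial_integral hgc R fun h => ?_
    rw [h, norm_zero] at hx
    linarith
  · refine ContinuousOn.smul ((hgc.comp continuous_norm).continuousOn.mul
      (continuous_norm.continuousOn.inv₀ fun x hx => ?_)) continuousOn_id
    have : R < ‖x‖ := hx
    linarith
  · intro η hη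
    have e : ∀ x, inner ℝ ((‖(g ‖x‖ * ‖x‖⁻¹) • x‖ ^ (p - 2) * A ‖(g ‖x‖ * ‖x‖⁻¹) • x‖) •
        (g ‖x‖ * ‖x‖⁻¹) • x) (gradient η x)
        = c * (‖x‖ ^ (-(p + ε)) * inner ℝ x (gradient η x))
          + k * (‖x‖ ^ (-(n : ℝ)) * inner ℝ x (gradient η x)) := by
      intro x
      by_cases hx : R < ‖x‖
      · have hx0 : 0 < ‖x‖ := by linarith
        have h1 : g ‖x‖ ^ (p - 2) * g ‖x‖ = g ‖x‖ ^ (p - 1) := by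
          have hgp : 0 < g ‖x‖ := lt_of_lt_of_le (by positivity) (hglow ‖x‖ (hR.trans hx.le))
          rw [← Real.rpow_add_one hgp.ne']; congr 1; ring
        have h2 : ‖x‖ ^ (-(p - 1 + ε)) * ‖x‖⁻¹ = ‖x‖ ^ (-(p + ε)) := by
          rw [← Real.rpow_neg_one, ← Real.rpow_add hx0]; congr 1; ring
        have h3 : ‖x‖ ^ (1 - (n : ℝ)) * ‖x‖⁻¹ = ‖x‖ ^ (-(n : ℝ)) := by
          rw [← Real.rpow_neg_one, ← Real.rpow_add hx0]; congr 1; ring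
        rw [hnorm x hx, smul_smul, inner_smul_left, ← h2, ← h3]
        have h4 := (hg1 ‖x‖ (hR.trans hx.le)).2
        have h5 : g ‖x‖ ^ (p - 2) * A (g ‖x‖) * (g ‖x‖ * ‖x‖⁻¹) = Φ ‖x‖ * ‖x‖⁻¹ := by
          rw [← h4, ← h1]; ring
        rw [h5]
        simp only [hΦ, conj_trivial]
        ring
      · have h2 : gradient η x = 0 := by
          have : fderiv ℝ η x = 0 := image_eq_zero_of_notMem_tsupport fun h =>
            hx (hη.tsupport_subset (tsupport_fderiv_subset ℝ h))
          simp [gradient, this]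
        simp [h2]
    have hi : ∀ a : ℝ, Integrable fun x : E n => ‖x‖ ^ a * inner ℝ x (gradient η x) := fun a => by
      simp_rw [inner_gradient_eq_fderiv]
      have hs : tsupport (fun x => fderiv ℝ η x x) ⊆ tsupport η :=
        (closure_mono fun x hx => Function.mem_support.2 fun h => Function.mem_support.1 hx
          (by simp [h])).trans (tsupport_fderiv_subset ℝ (f := η))
      exact integrable_mul_of_isCompact_tsupport ((continuousOn_norm_rpow (by linarith)
        a).locallyIntegrableOn (isOpen_norm_gt R).measurableSet)
        ((hη.contDiff.continuous_fderiv (by simp)).clm_apply continuous_id)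
        (hη.hasCompactSupport.of_isClosed_subset (isClosed_tsupport _) hs)
        (hs.trans hη.tsupport_subset)
    simp_rw [e]
    rw [integral_add ((hi _).const_mul c) ((hi _).const_mul k), integral_const_mul,
      integral_const_mul, integral_norm_rpow_mul_inner_gradient (by linarith) _ hη,
      integral_norm_rpow_mul_inner_gradient (by linarith) _ hη]
    simp_rw [mul_assoc]
    rw [integral_const_mul, hc]
    field_simp
    ring
  · intro B
    have hkL : 0 < (k / L) ^ q := by positivity
    -- The radius solves `(k / L) ^ q * log (ρ / R) = B`; the added `1` makes the inequality strict.
    refine ⟨R * Real.exp (B / (k / L) ^ q) + 1, fun x hx hx' => ?_⟩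
    have hx0 : 0 < ‖x‖ := by linarith
    have h1 : ∫ s in R..‖x‖, (k / L) ^ q * s⁻¹ ≤ ∫ s in R..‖x‖, g s := by
      refine intervalIntegral.integral_mono_on hx (hint _ _ hx ?_) (hgi _) fun s hs =>
        hglow s (hR.trans hs.1)
      exact continuousOn_const.mul (continuousOn_id.inv₀ fun s hs => (hpos s hs).ne')
    rw [intervalIntegral.integral_const_mul, integral_inv_of_pos (by linarith) hx0] at h1
    refine lt_of_lt_of_le ?_ h1
    rw [← div_lt_iff₀' hkL, Real.lt_log_iff_exp_lt (by positivity), lt_div_iff₀ (by linarith)]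
    linarith
  · intro x hx
    exact intervalIntegral.integral_nonneg hx fun s hs => (hg1 s (hR.trans hs.1)).1
  · intro x hx
    have hx0 : 0 < ‖x‖ := by linarith
    have hεq : 0 < ε * q := by positivity
    have hco : ContinuousOn (fun s : ℝ => (c / δ) ^ q * s ^ (-(1 + ε * q))) (Ici 1) :=
      continuousOn_const.mul (continuousOn_id.rpow_const fun s hs => Or.inl (hpos s hs).ne')
    have h1 : ∫ s in R..‖x‖, g s
        ≤ ∫ s in R..‖x‖, ((c / δ) ^ q * s ^ (-(1 + ε * q)) + (k / δ) ^ q) :=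
      intervalIntegral.integral_mono_on hx (hgi _) (hint _ _ hx (hco.add continuousOn_const))
        fun s hs => hgup s (hR.trans hs.1)
    rw [intervalIntegral.integral_add (hint _ _ hx hco) (hint _ _ hx continuousOn_const),
      intervalIntegral.integral_const_mul, intervalIntegral.integral_const,
      integral_rpow (Or.inr ⟨by linarith, by
        rw [uIcc_of_le hx]; exact fun h => by linarith [h.1]⟩)] at h1
    refine h1.trans ?_
    have e1 : -(1 + ε * q) + 1 = -(ε / (p - 1)) := by rw [hq]; ring
    have e2 : C₀ n p δ C ε = (c / δ) ^ q * ((p - 1) / ε) := by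
      rw [C₀, hc, div_div, mul_comm δ]
    have hp1' : p - 1 ≠ 0 := by linarith
    rw [e1, e2, smul_eq_mul, mul_comm (‖x‖ - R)]
    have h3 : 0 ≤ ‖x‖ ^ (-(ε / (p - 1))) := by positivity
    have e3 : (‖x‖ ^ (-(ε / (p - 1))) - R ^ (-(ε / (p - 1)))) / -(ε / (p - 1))
        = (p - 1) / ε * R ^ (-(ε / (p - 1))) - (p - 1) / ε * ‖x‖ ^ (-(ε / (p - 1))) := by
      field_simp
      ring
    rw [e3, mul_sub, ← mul_assoc, ← mul_assoc]
    -- The contribution of the endpoint `‖x‖` enters with a minus sign and is dropped; the endpoint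
    -- `R` gives the `C₀` term.
    have h4 : 0 ≤ (c / δ) ^ q * ((p - 1) / ε) * ‖x‖ ^ (-(ε / (p - 1))) := by
      have : 0 ≤ (p - 1) / ε := div_nonneg (by linarith) hε.le
      positivity
    linarith

/-! ### Mollification -/

/-- The mollification of `g` by the normalized bump function `φ`. -/
noncomputable def mollify {n : ℕ} {F : Type*} [NormedAddCommGroup F] [NormedSpace ℝ F]
    (φ : ContDiffBump (0 : E n)) (g : E n → F) : E n → F :=
  φ.normed volume ⋆[ContinuousLinearMap.lsmul ℝ ℝ, volume] g

section Mollify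

variable {n : ℕ} {F : Type*} [NormedAddCommGroup F] [NormedSpace ℝ F]
  (φ : ContDiffBump (0 : E n))

theorem integrable_mollify_integrand {g : E n → F} (hg : LocallyIntegrable g) (x : E n) :
    Integrable fun t => φ.normed volume t • g (x - t) :=
  φ.hasCompactSupport_normed.convolutionExists_left (ContinuousLinearMap.lsmul ℝ ℝ)
    φ.continuous_normed hg x

theorem contDiff_mollify {g : E n → F} (hg : LocallyIntegrable g) : ContDiff ℝ ∞ (mollify φ g) :=
  φ.hasCompactSupport_normed.contDiff_convolution_left _ φ.contDiff_normed hg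

theorem integral_mollify [CompleteSpace F] {g : E n → F} (hg : Integrable g) :
    ∫ x, mollify φ g x = ∫ x, g x := by
  rw [mollify, integral_convolution _ φ.integrable_normed hg, φ.integral_normed]
  simp

theorem integrable_mollify {g : E n → F} (hg : Integrable g) : Integrable (mollify φ g) :=
  φ.integrable_normed.integrable_convolution _ hg

theorem mollify_nonneg {g : E n → ℝ} (hg : ∀ x, 0 ≤ g x) (x : E n) : 0 ≤ mollify φ g x :=
  integral_nonneg fun t => mul_nonneg (φ.nonneg_normed t) (hg _)

theorem support_mollify_subset {g : E n → F} {T : Set (E n)} (hg : Function.support g ⊆ T) :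
    Function.support (mollify φ g) ⊆ Metric.cthickening φ.rOut T := by
  intro x hx
  obtain ⟨y, hy, z, hz, rfl⟩ := support_convolution_subset _ hx
  rw [φ.support_normed_eq, mem_ball_zero_iff] at hy
  exact Metric.mem_cthickening_of_dist_le _ z _ _ (hg hz) (by simpa using hy.le)

/-- The pointwise bound on mollified gradients that replaces Jensen's inequality. -/
theorem rpow_mul_norm_mollify_le {Z : E n → F} {p s : ℝ} (hp : 1 ≤ p) (hs : 0 ≤ s)
    (hZ : LocallyIntegrable Z) (hZp : LocallyIntegrable fun x => ‖Z x‖ ^ p) (x : E n) :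
    s ^ (p - 1) * ‖mollify φ Z x‖ ≤ s ^ p + mollify φ (fun x => ‖Z x‖ ^ p) x := by
  have h1 : ‖mollify φ Z x‖ ≤ ∫ t, φ.normed volume t * ‖Z (x - t)‖ := by
    refine (norm_integral_le_integral_norm _).trans_eq (integral_congr_ae ?_)
    filter_upwards with t
    rw [ContinuousLinearMap.lsmul_apply, norm_smul, Real.norm_of_nonneg (φ.nonneg_normed t)]
  have h2 : Integrable fun t => φ.normed volume t * ‖Z (x - t)‖ := by
    simpa only [norm_smul, Real.norm_of_nonneg (φ.nonneg_normed _)] using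
      (integrable_mollify_integrand φ hZ x).norm
  have h3 : Integrable fun t => φ.normed volume t * ‖Z (x - t)‖ ^ p :=
    integrable_mollify_integrand φ hZp x
  calc s ^ (p - 1) * ‖mollify φ Z x‖
      ≤ s ^ (p - 1) * ∫ t, φ.normed volume t * ‖Z (x - t)‖ :=
        mul_le_mul_of_nonneg_left h1 (Real.rpow_nonneg hs _)
    _ = ∫ t, s ^ (p - 1) * (φ.normed volume t * ‖Z (x - t)‖) := (integral_const_mul _ _).symm
    _ ≤ ∫ t, (φ.normed volume t * s ^ p + φ.normed volume t * ‖Z (x - t)‖ ^ p) := by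
        refine integral_mono (h2.const_mul _) ((φ.integrable_normed.mul_const _).add h3) fun t => ?_
        have := mul_le_mul_of_nonneg_left
          (rpow_sub_one_mul_le hp hs (norm_nonneg (Z (x - t)))) (φ.nonneg_normed (μ := volume) t)
        dsimp only
        linarith
    _ = s ^ p + mollify φ (fun x => ‖Z x‖ ^ p) x := by
        rw [integral_add (φ.integrable_normed.mul_const _) h3, integral_mul_const,
          φ.integral_normed, one_mul]
        rfl

/-- The gradient of a mollification is the mollification of the weak gradient. -/
theorem gradient_mollify {W : E n → ℝ} {Z : E n → E n} (hW : LocallyIntegrable W)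
    (hZ : LocallyIntegrable Z)
    (hweak : ∀ η, IsTestFunction univ η → ∀ v : E n,
      ∫ x, W x * fderiv ℝ η x v = - ∫ x, η x * inner ℝ (Z x) v) (x : E n) :
    gradient (mollify φ W) x = mollify φ Z x := by
  have hφd : Differentiable ℝ (φ.normed volume) :=
    (φ.contDiff_normed (n := 1)).differentiable (by simp)
  have h1 := φ.hasCompactSupport_normed.hasFDerivAt_convolution_right (μ := volume)
    (ContinuousLinearMap.lsmul ℝ ℝ).flip hW (φ.contDiff_normed (μ := volume) (n := 1)) x
  rw [convolution_flip] at h1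
  have hm : fderiv ℝ (mollify φ W) x = _ := h1.fderiv
  refine ext_inner_right ℝ fun v => ?_
  rw [real_inner_comm, inner_gradient_eq_fderiv, hm, convolution_precompR_apply _ hW
    (φ.hasCompactSupport_normed.fderiv ℝ) ((φ.contDiff_normed (n := 1)).continuous_fderiv
      (by simp)), convolution_def]
  -- The derivative falls on the kernel; the reflected kernel is itself a test function, so the weak
  -- gradient identity moves the derivative onto `W`.
  set η : E n → ℝ := fun t => φ.normed volume (x - t) with hη
  have hηf : ∀ t, fderiv ℝ η t v = - fderiv ℝ (φ.normed volume) (x - t) v := fun t => by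
    have h2 : HasFDerivAt η (fderiv ℝ (φ.normed volume) (x - t) ∘L
        (-(ContinuousLinearMap.id ℝ (E n)))) t := by
      refine (hφd (x - t)).hasFDerivAt.comp t ?_
      simpa using (hasFDerivAt_id t).const_sub x
    rw [h2.fderiv]
    simp
  have hηt : IsTestFunction univ η := by
    refine ⟨φ.contDiff_normed.comp (contDiff_const.sub contDiff_id), ?_, subset_univ _⟩
    exact φ.hasCompactSupport_normed.comp_homeomorph (Homeomorph.subLeft x)
  have h3 := hweak η hηt v
  simp_rw [hηf] at h3
  have h4 : ∫ t, η t * inner ℝ (Z t) v = inner ℝ (mollify φ Z x) v := by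
    rw [mollify, convolution_eq_swap, real_inner_comm]
    have hi : Integrable fun t => φ.normed volume (x - t) • Z t := by
      have := (integrable_mollify_integrand φ hZ x).comp_sub_left x
      simpa using this
    refine Eq.trans ?_ (integral_inner hi v)
    refine integral_congr_ae (Eventually.of_forall fun t => ?_)
    simp only [hη, inner_smul_right, real_inner_comm v]
  rw [← h4]
  have h5 : ∫ t, ((ContinuousLinearMap.lsmul ℝ ℝ).flip (W t))
      (fderiv ℝ (φ.normed volume) (x - t) v) = - ∫ t, W t * -fderiv ℝ (φ.normed volume) (x - t) v := by
    rw [← integral_neg]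
    refine integral_congr_ae (Eventually.of_forall fun t => ?_)
    simp [mul_comm]
  rw [h5, h3, neg_neg]

/-- A sequence of bump functions of uniformly comparable radii shrinking to zero. -/
theorem exists_seq_bump (n : ℕ) {r : ℝ} (hr : 0 < r) :
    ∃ φ : ℕ → ContDiffBump (0 : E n), (∀ j, (φ j).rOut ≤ r) ∧
      (∀ j, (φ j).rOut ≤ 2 * (φ j).rIn) ∧ Tendsto (fun j => (φ j).rOut) atTop (𝓝 0) := by
  have hpos : ∀ j : ℕ, 0 < r / ((j : ℝ) + 1) := fun j => by positivity
  refine ⟨fun j => ⟨r / (j + 1) / 2, r / (j + 1), half_pos (hpos j), half_lt_self (hpos j)⟩,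
    fun j => ?_, fun j => ?_, ?_⟩
  · exact div_le_self hr.le (by simp)
  · dsimp only; linarith
  · have := (tendsto_one_div_add_atTop_nhds_zero_nat (𝕜 := ℝ)).const_mul r
    simpa [div_eq_mul_inv] using this

/-- The bounded ratio of outer to inner radius makes the kernels comparable to ball averages, so
Lebesgue differentiation applies. -/
theorem tendsto_mollify_ae [CompleteSpace F] {φ : ℕ → ContDiffBump (0 : E n)}
    (h1 : Tendsto (fun j => (φ j).rOut) atTop (𝓝 0)) (h2 : ∀ j, (φ j).rOut ≤ 2 * (φ j).rIn)
    {g : E n → F} (hg : LocallyIntegrable g) :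
    ∀ᵐ x, Tendsto (fun j => mollify (φ j) g x) atTop (𝓝 (g x)) :=
  ContDiffBump.ae_convolution_tendsto_right_of_locallyIntegrable h1 (Eventually.of_forall h2) hg

end Mollify

/-! ### Cutoffs and localization -/

/-- A smooth cutoff function between a compact set and an open neighbourhood of it. -/
theorem exists_isTestFunction_eq_one {n : ℕ} {K Ω : Set (E n)} (hK : IsCompact K)
    (hΩ : IsOpen Ω) (hKΩ : K ⊆ Ω) :
    ∃ χ : E n → ℝ, IsTestFunction Ω χ ∧ (∀ x, 0 ≤ χ x) ∧ (∀ x, χ x ≤ 1) ∧ ∀ x ∈ K, χ x = 1 := by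
  obtain ⟨U, hU, hKU, hUΩ, hUc⟩ := exists_open_between_and_isCompact_closure hK hΩ hKΩ
  obtain ⟨χ, hχ, hr, hs, h1⟩ := exists_contMDiff_support_eq_eq_one_iff (n := ⊤)
    (modelWithCornersSelf ℝ (E n)) hU hK.isClosed hKU
  refine ⟨χ, ⟨contMDiff_iff_contDiff.1 hχ, ?_, ?_⟩, fun x => (hr ⟨x, rfl⟩).1,
    fun x => (hr ⟨x, rfl⟩).2, fun x hx => (h1 x).1 hx⟩
  · rwa [HasCompactSupport, tsupport, hs]
  · rwa [tsupport, hs]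

theorem setIntegral_eq_integral_of_tsupport_subset {n : ℕ} {Ω : Set (E n)} {η g : E n → ℝ}
    (hs : tsupport η ⊆ Ω) (hg : ∀ x ∉ tsupport η, g x = 0) : ∫ x in Ω, g x = ∫ x, g x :=
  setIntegral_eq_integral_of_forall_compl_eq_zero fun x hx => hg x fun h => hx (hs h)

theorem gradient_eq_zero_of_notMem_tsupport {n : ℕ} {η : E n → ℝ} {x : E n}
    (hx : x ∉ tsupport η) : gradient η x = 0 := by
  have : fderiv ℝ η x = 0 :=
    image_eq_zero_of_notMem_tsupport fun h => hx (tsupport_fderiv_subset ℝ h)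
  simp [gradient, this]

theorem IsTestFunction.continuous_gradient {n : ℕ} {Ω : Set (E n)} {η : E n → ℝ}
    (h : IsTestFunction Ω η) : Continuous (gradient η) :=
  (InnerProductSpace.toDual ℝ (E n)).symm.continuous.comp
    (h.contDiff.continuous_fderiv (by simp))

theorem integrable_inner_gradient {n : ℕ} {Ω : Set (E n)} {X : E n → E n} {η : E n → ℝ}
    (hX : LocallyIntegrableOn X Ω) (hη : IsTestFunction Ω η) :
    Integrable fun x => inner ℝ (X x) (gradient η x) := by
  have hc := hη.hasCompactSupport
  obtain ⟨M, hM⟩ := hc.isCompact.exists_bound_of_continuousOn hη.continuous_gradient.continuousOn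
  have hXi : IntegrableOn X (tsupport η) := hX.integrableOn_compact_subset hη.tsupport_subset hc
  have h1 : IntegrableOn (fun x => inner ℝ (X x) (gradient η x)) (tsupport η) := by
    refine (hXi.norm.mul_const M).mono' (hXi.aestronglyMeasurable.inner
      hη.continuous_gradient.aestronglyMeasurable) ?_
    filter_upwards [ae_restrict_mem (isClosed_tsupport η).measurableSet] with x hx
    exact (norm_inner_le_norm _ _).trans
      (mul_le_mul_of_nonneg_left (hM x hx) (norm_nonneg _))
  refine (integrableOn_iff_integrable_of_support_subset ?_).1 h1
  intro x hx
  by_contra h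
  exact hx (by simp [gradient_eq_zero_of_notMem_tsupport h])

/-- The nonlinear field of an `L^p_loc` gradient is locally integrable. -/
theorem StructureConditions.locallyIntegrableOn_field {n : ℕ} {p δ L : ℝ} {A : ℝ → ℝ}
    (hA : StructureConditions p δ L A) (hp : 2 ≤ p) {Ω : Set (E n)} (hΩ : IsOpen Ω)
    {G : E n → E n} (hG : MemLpLoc p Ω G) :
    LocallyIntegrableOn (fun x => (‖G x‖ ^ (p - 2) * A ‖G x‖) • G x) Ω := by
  refine (locallyIntegrableOn_iff hΩ.isLocallyClosed).2 fun K hKΩ hK => ?_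
  have hGK := hG K hK hKΩ
  have hp0 : ENNReal.ofReal p ≠ 0 := by simp; linarith
  have hi := hGK.integrable_norm_rpow hp0 ENNReal.ofReal_ne_top
  rw [ENNReal.toReal_ofReal (by linarith)] at hi
  have : IsFiniteMeasure (volume.restrict K) := ⟨by simpa using hK.measure_lt_top⟩
  refine Integrable.mono' ((hi.add (integrable_const (1 : ℝ))).const_mul L)
    ((hA.continuous_field hp).comp_aestronglyMeasurable hGK.aestronglyMeasurable) ?_
  filter_upwards with x
  refine (hA.norm_field_le hp (G x)).trans (mul_le_mul_of_nonneg_left ?_ hA.L_pos.le)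
  -- Young with second factor `1`: `‖G‖ ^ (p - 1) ≤ ‖G‖ ^ p + 1`, integrable on compact sets.
  have := rpow_sub_one_mul_le (p := p) (by linarith) (norm_nonneg (G x)) zero_le_one
  simpa using this

section Localization

variable {n : ℕ} {Ω : Set (E n)} {u V χ : E n → ℝ} {G H : E n → E n}

/-- The product rule for the weak gradient of `χ (u - V)`. -/
theorem integral_cutoff_mul_fderiv (hΩ : IsOpen Ω) (hu : HasWeakGradient Ω u G)
    (hV : ∀ x ∈ Ω, HasGradientAt V (H x) x) (hH : ContinuousOn H Ω) (hχ : IsTestFunction Ω χ)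
    {η : E n → ℝ} (hη : IsTestFunction univ η) (v : E n) :
    ∫ x, (χ x * (u x - V x)) * fderiv ℝ η x v
      = - ∫ x, η x * inner ℝ (χ x • (G x - H x) + (u x - V x) • gradient χ x) v := by
  have hVc : ContinuousOn V Ω := fun x hx => (hV x hx).continuousAt.continuousWithinAt
  have hVl : LocallyIntegrableOn V Ω := hVc.locallyIntegrableOn hΩ.measurableSet
  have hts : tsupport (fun x => χ x * η x) ⊆ tsupport χ :=
    closure_mono fun x hx => left_ne_zero_of_mul hx
  -- `η` need not be supported in `Ω`, but `χ η` is, so it is admissible both for `u` and for `V`.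
  have hψ : IsTestFunction Ω (fun x => χ x * η x) :=
    ⟨hχ.contDiff.mul hη.contDiff, hχ.hasCompactSupport.mul_right, hts.trans hχ.tsupport_subset⟩
  set ψ : E n → ℝ := fun x => χ x * η x with hψdef
  have hψf : ∀ x, fderiv ℝ ψ x v = χ x * fderiv ℝ η x v + η x * fderiv ℝ χ x v := fun x => by
    rw [hψdef, fderiv_fun_mul (hχ.contDiff.differentiable (by simp) x)
      (hη.contDiff.differentiable (by simp) x)]
    simp
  have hψs : tsupport (fun x => fderiv ℝ ψ x v) ⊆ tsupport ψ := tsupport_fderiv_apply_subset ℝ v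
  have h1 : ∫ x, u x * fderiv ℝ ψ x v = - ∫ x, ψ x * inner ℝ (G x) v := by
    have := hu.integral_eq ψ hψ v
    rwa [setIntegral_eq_integral_of_tsupport_subset (η := ψ) hψ.tsupport_subset,
      setIntegral_eq_integral_of_tsupport_subset (η := ψ) hψ.tsupport_subset] at this
    · intro x hx; rw [image_eq_zero_of_notMem_tsupport hx, zero_mul]
    · intro x hx
      rw [image_eq_zero_of_notMem_tsupport (f := fun x => fderiv ℝ ψ x v) fun h => hx (hψs h),
        mul_zero]
  have h2 := integral_mul_fderiv_of_hasGradientAt hΩ hV hH hψ v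
  have hψfc := hψ.continuous_fderiv_apply v
  have hψfs := hψ.hasCompactSupport.fderiv_apply ℝ v
  have i1 : Integrable fun x => u x * fderiv ℝ ψ x v :=
    integrable_mul_of_isCompact_tsupport hu.locallyIntegrableOn hψfc hψfs
      (hψs.trans hψ.tsupport_subset)
  have i2 : Integrable fun x => V x * fderiv ℝ ψ x v :=
    integrable_mul_of_isCompact_tsupport hVl hψfc hψfs (hψs.trans hψ.tsupport_subset)
  have hin : ∀ X : E n → E n, LocallyIntegrableOn X Ω →
      Integrable fun x => ψ x * inner ℝ (X x) v := fun X hX => by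
    have hX' : LocallyIntegrableOn (fun x => inner ℝ (X x) v) Ω := fun x hx => by
      obtain ⟨s, hs, hs'⟩ := hX x hx
      exact ⟨s, hs, Integrable.inner_const hs' v⟩
    simpa only [mul_comm] using integrable_mul_of_isCompact_tsupport hX' hψ.contDiff.continuous
      hψ.hasCompactSupport hψ.tsupport_subset
  have i3 := hin G hu.locallyIntegrableOn_grad
  have i4 := hin H (hH.locallyIntegrableOn hΩ.measurableSet)
  have hχs : tsupport (fun x => η x * fderiv ℝ χ x v) ⊆ tsupport χ :=
    (closure_mono fun x hx => right_ne_zero_of_mul hx).trans (tsupport_fderiv_apply_subset ℝ v)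
  have hχc : HasCompactSupport (fun x => η x * fderiv ℝ χ x v) :=
    hχ.hasCompactSupport.of_isClosed_subset (isClosed_tsupport _) hχs
  have hχd : Continuous (fun x => η x * fderiv ℝ χ x v) :=
    hη.contDiff.continuous.mul (hχ.continuous_fderiv_apply v)
  have i5 : Integrable fun x => u x * (η x * fderiv ℝ χ x v) :=
    integrable_mul_of_isCompact_tsupport hu.locallyIntegrableOn hχd hχc
      (hχs.trans hχ.tsupport_subset)
  have i6 : Integrable fun x => V x * (η x * fderiv ℝ χ x v) :=
    integrable_mul_of_isCompact_tsupport hVl hχd hχc (hχs.trans hχ.tsupport_subset)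
  have e1 : ∀ x, (χ x * (u x - V x)) * fderiv ℝ η x v
      = (u x * fderiv ℝ ψ x v - V x * fderiv ℝ ψ x v)
        - (u x * (η x * fderiv ℝ χ x v) - V x * (η x * fderiv ℝ χ x v)) := fun x => by
    rw [hψf]; ring
  have e2 : ∀ x, η x * inner ℝ (χ x • (G x - H x) + (u x - V x) • gradient χ x) v
      = (ψ x * inner ℝ (G x) v - ψ x * inner ℝ (H x) v)
        + (u x * (η x * fderiv ℝ χ x v) - V x * (η x * fderiv ℝ χ x v)) := fun x => by
    rw [inner_add_left, inner_smul_left, inner_smul_left, inner_sub_left,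
      real_inner_comm v (gradient χ x), inner_gradient_eq_fderiv]
    simp only [conj_trivial, hψdef]
    ring
  simp_rw [e1, e2]
  have i12 : Integrable fun x => u x * fderiv ℝ ψ x v - V x * fderiv ℝ ψ x v := i1.sub i2
  have i34 : Integrable fun x => ψ x * inner ℝ (G x) v - ψ x * inner ℝ (H x) v := i3.sub i4
  have i56 : Integrable fun x => u x * (η x * fderiv ℝ χ x v) - V x * (η x * fderiv ℝ χ x v) :=
    i5.sub i6
  rw [integral_sub i12 i56, integral_add i34 i56,
    integral_sub i1 i2, integral_sub i3 i4, h1, h2]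
  ring

theorem continuous_cutoff_mul (hu : ContinuousOn u Ω) (hV : ContinuousOn V Ω)
    (hχ : IsTestFunction Ω χ) (hΩ : IsOpen Ω) : Continuous fun x => χ x * (u x - V x) := by
  refine continuous_of_tsupport fun x hx => ?_
  have hts : tsupport (fun x => χ x * (u x - V x)) ⊆ tsupport χ :=
    closure_mono fun x hx => left_ne_zero_of_mul hx
  have hxΩ := hΩ.mem_nhds (hχ.tsupport_subset (hts hx))
  exact hχ.contDiff.continuous.continuousAt.mul
    ((hu.continuousAt hxΩ).sub (hV.continuousAt hxΩ))

theorem memLp_restrict_of_continuousOn {F : Type*} [NormedAddCommGroup F]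
    {K : Set (E n)} (hK : IsCompact K) {g : E n → F} (hg : ContinuousOn g K) (q : ℝ≥0∞) :
    MemLp g q (volume.restrict K) := by
  have : IsFiniteMeasure (volume.restrict K) := ⟨by simpa using hK.measure_lt_top⟩
  obtain ⟨M, hM⟩ := hK.exists_bound_of_continuousOn hg
  refine MemLp.of_bound (hg.aestronglyMeasurable_of_isCompact hK hK.measurableSet) M ?_
  filter_upwards [ae_restrict_mem hK.measurableSet] with x hx using hM x hx

/-- The weak gradient of `χ (u - V)` belongs to `L^p`. -/
theorem memLp_cutoff_gradient {p : ℝ} (hu : ContinuousOn u Ω)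
    (hV : ContinuousOn V Ω) (hG : MemLpLoc p Ω G) (hH : ContinuousOn H Ω)
    (hχ : IsTestFunction Ω χ) (hχ0 : ∀ x, 0 ≤ χ x) (hχ1 : ∀ x, χ x ≤ 1) :
    MemLp (fun x => χ x • (G x - H x) + (u x - V x) • gradient χ x) (ENNReal.ofReal p) := by
  set T := tsupport χ
  have hT : IsCompact T := hχ.hasCompactSupport
  have hTΩ : T ⊆ Ω := hχ.tsupport_subset
  have h1 : MemLp (fun x => G x - H x) (ENNReal.ofReal p) (volume.restrict T) :=
    (hG T hT hTΩ).sub (memLp_restrict_of_continuousOn hT (hH.mono hTΩ) _)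
  have h2 : MemLp (fun x => χ x • (G x - H x)) (ENNReal.ofReal p) (volume.restrict T) := by
    refine h1.of_le (hχ.contDiff.continuous.aestronglyMeasurable.smul h1.aestronglyMeasurable) ?_
    filter_upwards with x
    rw [norm_smul, Real.norm_of_nonneg (hχ0 x)]
    exact mul_le_of_le_one_left (norm_nonneg _) (hχ1 x)
  have h3 : MemLp (fun x => (u x - V x) • gradient χ x) (ENNReal.ofReal p) (volume.restrict T) :=
    memLp_restrict_of_continuousOn hT
      (((hu.sub hV).mono hTΩ).smul hχ.continuous_gradient.continuousOn) _
  have h4 := (memLp_indicator_iff_restrict hT.measurableSet).2 (h2.add h3)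
  convert! h4 using 1
  ext1 x
  by_cases hx : x ∈ T
  · simp [hx]
  · simp [hx, image_eq_zero_of_notMem_tsupport hx, gradient_eq_zero_of_notMem_tsupport hx]

end Localization

/-! ### Smooth truncation of the positive part -/

theorem deriv_smoothTransition_nonneg (s : ℝ) : 0 ≤ deriv Real.smoothTransition s :=
  Real.smoothTransition.monotone.deriv_nonneg

theorem deriv_smoothTransition_of_nonpos {s : ℝ} (hs : s ≤ 0) :
    deriv Real.smoothTransition s = 0 := by
  refine IsLocalMin.deriv_eq_zero (Eventually.of_forall fun t => ?_)
  rw [Real.smoothTransition.zero_of_nonpos hs]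
  exact Real.smoothTransition.nonneg t

/-- Outside `[0, 1]` every point is a global extremum, so the derivative vanishes there and
compactness gives the bound. -/
theorem exists_deriv_smoothTransition_le :
    ∃ M : ℝ, 0 ≤ M ∧ ∀ s, deriv Real.smoothTransition s ≤ M := by
  have hc : Continuous (deriv Real.smoothTransition) :=
    (Real.smoothTransition.contDiff (n := 1)).continuous_deriv (by simp)
  obtain ⟨M, hM⟩ := (isCompact_Icc (a := (0 : ℝ)) (b := 1)).exists_bound_of_continuousOn
    hc.continuousOn
  have hM0 : 0 ≤ M := (norm_nonneg _).trans (hM 0 (by simp))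
  refine ⟨M, hM0, fun s => ?_⟩
  by_cases hs : s ∈ Icc (0 : ℝ) 1
  · exact (le_abs_self _).trans (hM s hs)
  · rcases le_or_gt s 0 with h | h
    · rw [deriv_smoothTransition_of_nonpos h]; exact hM0
    · have h1 : 1 < s := by
        by_contra! h'
        exact hs ⟨h.le, h'⟩
      have : deriv Real.smoothTransition s = 0 := by
        refine IsLocalMax.deriv_eq_zero (Eventually.of_forall fun t => ?_)
        rw [Real.smoothTransition.one_of_one_le h1.le]
        exact Real.smoothTransition.le_one t
      rw [this]; exact hM0

theorem gradient_smoothTransition_comp {n : ℕ} {w : E n → ℝ} {x : E n}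
    (hw : DifferentiableAt ℝ w x) :
    gradient (fun y => Real.smoothTransition (w y)) x
      = deriv Real.smoothTransition (w x) • gradient w x := by
  have h1 : HasDerivAt Real.smoothTransition (deriv Real.smoothTransition (w x)) (w x) :=
    ((Real.smoothTransition.contDiff (n := 1)).differentiable (by simp) _).hasDerivAt
  have h2 := h1.comp_hasFDerivAt x hw.hasFDerivAt
  rw [gradient, gradient, ← map_smul]
  exact congrArg _ h2.fderiv

/-- Smooth positive truncations of mollifications of a compactly supported function are test
functions. -/
theorem isTestFunction_smoothTransition_mollify {n : ℕ} (φ : ContDiffBump (0 : E n))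
    {W : E n → ℝ} (hW : Continuous W) {T Ω : Set (E n)} (hT : IsCompact T)
    (hWT : Function.support W ⊆ T) {r : ℝ} (hφ : φ.rOut ≤ r) (hTΩ : Metric.cthickening r T ⊆ Ω) :
    IsTestFunction Ω (fun x => Real.smoothTransition (mollify φ W x)) ∧
      tsupport (fun x => Real.smoothTransition (mollify φ W x)) ⊆ Metric.cthickening r T := by
  have hs : tsupport (fun x => Real.smoothTransition (mollify φ W x))
      ⊆ Metric.cthickening r T := by
    refine closure_minimal (fun x hx => ?_) Metric.isClosed_cthickening
    refine Metric.cthickening_mono hφ T (support_mollify_subset φ hWT fun h => hx ?_)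
    simp only [h, Real.smoothTransition.zero]
  refine ⟨⟨Real.smoothTransition.contDiff.comp (contDiff_mollify φ hW.locallyIntegrable), ?_,
    hs.trans hTΩ⟩, hs⟩
  exact hT.cthickening.of_isClosed_subset (isClosed_tsupport _) hs

/-! ### The comparison principle -/

/-- Comparison of a weak solution with a strict `C¹` supersolution. -/
theorem StructureConditions.le_of_strict_supersolution {n : ℕ} {p δ L : ℝ} {A : ℝ → ℝ}
    (hA : StructureConditions p δ L A) (hp : 2 ≤ p) {Ω : Set (E n)} (hΩ : IsOpen Ω)
    {u V f b c : E n → ℝ} {G H : E n → E n} (hu : ContinuousOn u Ω) (hG : MemW1pLoc p Ω u G)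
    (hV : ∀ x ∈ Ω, HasGradientAt V (H x) x) (hH : ContinuousOn H Ω)
    (hf : LocallyIntegrableOn f Ω) (hb : ContinuousOn b Ω) (hc : ContinuousOn c Ω)
    (hc0 : ∀ x ∈ Ω, 0 < c x) (hfb : ∀ᵐ x, x ∈ Ω → f x + c x ≤ b x)
    (hueq : ∀ η, IsTestFunction Ω η →
      ∫ x, inner ℝ ((‖G x‖ ^ (p - 2) * A ‖G x‖) • G x) (gradient η x) = ∫ x, f x * η x)
    (hVeq : ∀ η, IsTestFunction Ω η →
      ∫ x, inner ℝ ((‖H x‖ ^ (p - 2) * A ‖H x‖) • H x) (gradient η x) = ∫ x, b x * η x)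
    (hK : IsCompact {x | x ∈ Ω ∧ V x ≤ u x}) : ∀ x ∈ Ω, u x ≤ V x := by
  have hL := hA.L_pos
  have hVc : ContinuousOn V Ω := fun x hx => (hV x hx).continuousAt.continuousWithinAt
  obtain ⟨χ, hχ, hχ0, hχ1, hχK⟩ := exists_isTestFunction_eq_one hK hΩ fun x hx => hx.1
  set T := tsupport χ
  have hT : IsCompact T := hχ.hasCompactSupport
  obtain ⟨r, hr, hrΩ⟩ := hT.exists_cthickening_subset_open hΩ hχ.tsupport_subset
  set N := Metric.cthickening r T
  have hN : IsCompact N := hT.cthickening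
  have hNm : MeasurableSet N := hN.isClosed.measurableSet
  have hTN : T ⊆ N := Metric.self_subset_cthickening T
  -- Since `χ = 1` wherever `V ≤ u` in `Ω`, the positive part of `W` there is exactly that of `u -
  -- V`.
  set W : E n → ℝ := fun x => χ x * (u x - V x) with hWdef
  set Z : E n → E n := fun x => χ x • (G x - H x) + (u x - V x) • gradient χ x with hZdef
  have hWc : Continuous W := continuous_cutoff_mul hu hVc hχ hΩ
  have hWT : Function.support W ⊆ T := fun x hx => subset_tsupport χ (left_ne_zero_of_mul hx)
  have hZT : ∀ x ∉ T, Z x = 0 := fun x hx => by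
    simp [hZdef, image_eq_zero_of_notMem_tsupport hx, gradient_eq_zero_of_notMem_tsupport hx]
  have hZp : MemLp Z (ENNReal.ofReal p) :=
    memLp_cutoff_gradient hu hVc hG.memLpLoc_grad hH hχ hχ0 hχ1
  have hp0 : ENNReal.ofReal p ≠ 0 := by simp; linarith
  have hZl : LocallyIntegrable Z := hZp.locallyIntegrable (by simp; linarith)
  have hZi : Integrable fun x => ‖Z x‖ ^ p := by
    have := hZp.integrable_norm_rpow hp0 ENNReal.ofReal_ne_top
    rwa [ENNReal.toReal_ofReal (by linarith)] at this
  have hweak : ∀ η, IsTestFunction univ η → ∀ v : E n,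
      ∫ x, W x * fderiv ℝ η x v = - ∫ x, η x * inner ℝ (Z x) v := fun η hη v =>
    integral_cutoff_mul_fderiv hΩ hG.hasWeakGradient hV hH hχ hη v
  obtain ⟨φ, hφr, hφ2, hφ0⟩ := exists_seq_bump n hr
  set B : E n → E n := fun x =>
    (‖G x‖ ^ (p - 2) * A ‖G x‖) • G x - (‖H x‖ ^ (p - 2) * A ‖H x‖) • H x with hBdef
  set β : E n → ℝ := fun x => ‖G x‖ + ‖H x‖ with hβdef
  have hHp : MemLpLoc p Ω H := fun K hK hKΩ => memLp_restrict_of_continuousOn hK (hH.mono hKΩ) _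
  have hβi : IntegrableOn (fun x => β x ^ p) N := by
    have h1 : MemLp β (ENNReal.ofReal p) (volume.restrict N) :=
      (hG.memLpLoc_grad N hN hrΩ).norm.add (hHp N hN hrΩ).norm
    have := h1.integrable_norm_rpow hp0 ENNReal.ofReal_ne_top
    rw [ENNReal.toReal_ofReal (by linarith)] at this
    refine this.congr (Eventually.of_forall fun x => ?_)
    simp only [Real.norm_of_nonneg (add_nonneg (norm_nonneg (G x)) (norm_nonneg (H x))), hβdef]
  have hBle : ∀ x, ‖B x‖ ≤ 2 * L * β x ^ (p - 1) := fun x => by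
    have h1 : ‖G x‖ ^ (p - 1) ≤ β x ^ (p - 1) := Real.rpow_le_rpow (norm_nonneg _)
      (le_add_of_nonneg_right (norm_nonneg _)) (by linarith)
    have h2 : ‖H x‖ ^ (p - 1) ≤ β x ^ (p - 1) := Real.rpow_le_rpow (norm_nonneg _)
      (le_add_of_nonneg_left (norm_nonneg _)) (by linarith)
    have h3 := hA.norm_field_le hp (G x)
    have h4 := hA.norm_field_le hp (H x)
    have := norm_sub_le ((‖G x‖ ^ (p - 2) * A ‖G x‖) • G x) ((‖H x‖ ^ (p - 2) * A ‖H x‖) • H x)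
    calc ‖B x‖ ≤ L * ‖G x‖ ^ (p - 1) + L * ‖H x‖ ^ (p - 1) := by linarith
      _ ≤ L * β x ^ (p - 1) + L * β x ^ (p - 1) := by gcongr
      _ = _ := by ring
  obtain ⟨M, hM0, hM⟩ := exists_deriv_smoothTransition_le
  set η : ℕ → E n → ℝ := fun j x => Real.smoothTransition (mollify (φ j) W x) with hηdef
  have hη : ∀ j, IsTestFunction Ω (η j) ∧ tsupport (η j) ⊆ N := fun j =>
    isTestFunction_smoothTransition_mollify (φ j) hWc hT hWT (hφr j) hrΩ
  have hηg : ∀ j x, gradient (η j) x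
      = deriv Real.smoothTransition (mollify (φ j) W x) • mollify (φ j) Z x := fun j x => by
    rw [hηdef, gradient_smoothTransition_comp ((contDiff_mollify (φ j)
      hWc.locallyIntegrable).differentiable (by simp) x),
      gradient_mollify (φ j) hWc.locallyIntegrable hZl hweak]
  set D : ℕ → E n → ℝ := fun j x => inner ℝ (B x) (gradient (η j) x) + c x * η j x with hDdef
  set d : E n → ℝ := fun x => deriv Real.smoothTransition (W x) * inner ℝ (B x) (Z x)
    + c x * Real.smoothTransition (W x) with hddef
  -- `P j` dominates the possibly negative term of `D j`: before the limit, the mollified `Z` is not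
  -- `G - H`, so monotonicity gives no sign.
  set P : ℕ → E n → ℝ := fun j x =>
    2 * L * M * (β x ^ p + mollify (φ j) (fun x => ‖Z x‖ ^ p) x) with hPdef
  set h : E n → ℝ := fun x => 2 * L * M * (β x ^ p + ‖Z x‖ ^ p) with hhdef
  have hGl := hA.locallyIntegrableOn_field hp hΩ hG.memLpLoc_grad
  have hHl := hA.locallyIntegrableOn_field hp hΩ hHp
  have iG : ∀ j, Integrable fun x =>
      inner ℝ ((‖G x‖ ^ (p - 2) * A ‖G x‖) • G x) (gradient (η j) x) := fun j =>
    integrable_inner_gradient hGl (hη j).1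
  have iH : ∀ j, Integrable fun x =>
      inner ℝ ((‖H x‖ ^ (p - 2) * A ‖H x‖) • H x) (gradient (η j) x) := fun j =>
    integrable_inner_gradient hHl (hη j).1
  have ig : ∀ (g : E n → ℝ), LocallyIntegrableOn g Ω → ∀ j, Integrable fun x => g x * η j x :=
    fun g hg j => integrable_mul_of_isCompact_tsupport hg (hη j).1.contDiff.continuous
      (hη j).1.hasCompactSupport (hη j).1.tsupport_subset
  have hcl : LocallyIntegrableOn c Ω := hc.locallyIntegrableOn hΩ.measurableSet
  have hbl : LocallyIntegrableOn b Ω := hb.locallyIntegrableOn hΩ.measurableSet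
  have iB : ∀ j, Integrable fun x => inner ℝ (B x) (gradient (η j) x) := fun j => by
    refine ((iG j).sub (iH j)).congr (Eventually.of_forall fun x => ?_)
    simp only [hBdef, inner_sub_left, Pi.sub_apply]
  have iD : ∀ j, Integrable (D j) := fun j => (iB j).add (ig c hcl j)
  -- Subtracting the two equations turns the integral into that of `(f - b + c) η j`, and `f + c ≤
  -- b`.
  have hDint : ∀ j, ∫ x in N, D j x ≤ 0 := fun j => by
    have e0 : ∫ x in N, D j x = ∫ x, D j x :=
      setIntegral_eq_integral_of_tsupport_subset (hη j).2 fun x hx => by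
        simp only [hDdef, gradient_eq_zero_of_notMem_tsupport hx,
          image_eq_zero_of_notMem_tsupport hx, inner_zero_right, mul_zero, add_zero]
    have e1 : ∫ x, D j x = (∫ x, f x * η j x) - (∫ x, b x * η j x) + ∫ x, c x * η j x := by
      rw [← hueq _ (hη j).1, ← hVeq _ (hη j).1, ← integral_sub' (iG j) (iH j),
        ← integral_add' ((iG j).sub (iH j)) (ig c hcl j)]
      simp only [hDdef, hBdef, inner_sub_left, Pi.sub_apply, Pi.add_apply]
    have e2 : (∫ x, f x * η j x) + (∫ x, c x * η j x) ≤ ∫ x, b x * η j x := by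
      rw [← integral_add (ig f hf j) (ig c hcl j)]
      refine integral_mono_ae ((ig f hf j).add (ig c hcl j)) (ig b hbl j) ?_
      filter_upwards [hfb] with x hx
      by_cases hxΩ : x ∈ Ω
      · have := mul_le_mul_of_nonneg_right (hx hxΩ)
          (Real.smoothTransition.nonneg (mollify (φ j) W x))
        simp only [hηdef]
        linarith
      · have : η j x = 0 := image_eq_zero_of_notMem_tsupport fun h =>
          hxΩ ((hη j).1.tsupport_subset h)
        simp [this]
    rw [e0, e1]
    linarith
  have hβ0 : ∀ x, 0 ≤ β x := fun x => add_nonneg (norm_nonneg _) (norm_nonneg _)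
  have hle : ∀ j, 0 ≤ᵐ[volume.restrict N] D j + P j := fun j => by
    filter_upwards [ae_restrict_mem hNm] with x hx
    have h1 : |inner ℝ (B x) (gradient (η j) x)| ≤ P j x := by
      rw [hηg, inner_smul_right, abs_mul, abs_of_nonneg (deriv_smoothTransition_nonneg _)]
      calc deriv Real.smoothTransition (mollify (φ j) W x) * |inner ℝ (B x) (mollify (φ j) Z x)|
          ≤ M * ((2 * L * β x ^ (p - 1)) * ‖mollify (φ j) Z x‖) := by
            refine mul_le_mul (hM _) ((abs_real_inner_le_norm _ _).trans ?_) (abs_nonneg _) hM0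
            exact mul_le_mul_of_nonneg_right (hBle x) (norm_nonneg _)
        _ = 2 * L * M * (β x ^ (p - 1) * ‖mollify (φ j) Z x‖) := by ring
        _ ≤ P j x := by
            refine mul_le_mul_of_nonneg_left ?_ (by positivity)
            exact rpow_mul_norm_mollify_le (φ j) (by linarith) (hβ0 x) hZl
              hZi.locallyIntegrable x
    have h2 : 0 ≤ c x * η j x :=
      mul_nonneg (hc0 x (hrΩ hx)).le (Real.smoothTransition.nonneg _)
    have := neg_abs_le (inner ℝ (B x) (gradient (η j) x))
    simp only [Pi.zero_apply, Pi.add_apply, hDdef]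
    linarith
  have iP : ∀ j, IntegrableOn (P j) N := fun j =>
    (hβi.add (integrable_mollify (φ j) hZi).integrableOn).const_mul _
  have ih : IntegrableOn h N := (hβi.add hZi.integrableOn).const_mul _
  -- Mollification preserves the total integral of `‖Z‖ ^ p`, which lives in `N`; restricting to `N`
  -- can only lose mass.
  have hPint : ∀ j, ∫ x in N, P j x ≤ ∫ x in N, h x := fun j => by
    have e1 : ∫ x in N, mollify (φ j) (fun x => ‖Z x‖ ^ p) x ≤ ∫ x in N, ‖Z x‖ ^ p := by
      have e2 : ∫ x in N, ‖Z x‖ ^ p = ∫ x, ‖Z x‖ ^ p :=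
        setIntegral_eq_integral_of_forall_compl_eq_zero fun x hx => by
          rw [hZT x fun h => hx (hTN h), norm_zero, Real.zero_rpow (by linarith)]
      rw [e2, ← integral_mollify (φ j) hZi]
      exact setIntegral_le_integral (integrable_mollify (φ j) hZi) (Eventually.of_forall
        (mollify_nonneg (φ j) fun x => Real.rpow_nonneg (norm_nonneg _) _))
    simp only [hPdef, hhdef]
    rw [integral_const_mul, integral_const_mul]
    refine mul_le_mul_of_nonneg_left ?_ (by positivity)
    rw [integral_add hβi (integrable_mollify (φ j) hZi).integrableOn,
      integral_add hβi hZi.integrableOn]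
    linarith
  have hdc : Continuous (deriv Real.smoothTransition) :=
    (Real.smoothTransition.contDiff (n := 1)).continuous_deriv (by simp)
  have hWlim := tendsto_mollify_ae hφ0 hφ2 hWc.locallyIntegrable
  have hDlim : ∀ᵐ x ∂(volume.restrict N), Tendsto (fun j => D j x) atTop (𝓝 (d x)) := by
    refine ae_restrict_of_ae ?_
    filter_upwards [hWlim, tendsto_mollify_ae hφ0 hφ2 hZl] with x hx hx'
    simp only [hDdef, hηg, hddef, inner_smul_right]
    exact (((hdc.tendsto _).comp hx).mul (tendsto_const_nhds.inner hx')).add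
      (((Real.smoothTransition.continuous.tendsto _).comp hx).const_mul _)
  have hPlim : ∀ᵐ x ∂(volume.restrict N), Tendsto (fun j => P j x) atTop (𝓝 (h x)) := by
    refine ae_restrict_of_ae ?_
    filter_upwards [tendsto_mollify_ae hφ0 hφ2 hZi.locallyIntegrable] with x hx
    exact (hx.const_add _).const_mul _
  have hdm : AEMeasurable d (volume.restrict N) :=
    aemeasurable_of_tendsto_metrizable_ae atTop (fun j => (iD j).integrableOn.aemeasurable) hDlim
  have hdc' : ∀ x ∈ N, c x * Real.smoothTransition (W x) ≤ d x := fun x hx => by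
    refine le_add_of_nonneg_left ?_
    rcases le_or_gt (W x) 0 with hW | hW
    · rw [deriv_smoothTransition_of_nonpos hW, zero_mul]
    · have huV : 0 < u x - V x := by
        by_contra! hneg
        exact absurd hW (not_lt.2 (mul_nonpos_of_nonneg_of_nonpos (hχ0 x) hneg))
      have h1 : χ x = 1 := hχK x ⟨hrΩ hx, by linarith⟩
      -- `χ` attains its maximum `1` at `x`, so its gradient vanishes, `Z = G - H`, and monotonicity
      -- of the field gives the sign.
      have h2 : gradient χ x = 0 := by
        have : fderiv ℝ χ x = 0 := IsLocalMax.fderiv_eq_zero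
          (Eventually.of_forall fun y => by rw [h1]; exact hχ1 y)
        simp [gradient, this]
      refine mul_nonneg (deriv_smoothTransition_nonneg _) ?_
      have : Z x = G x - H x := by simp [hZdef, h1, h2]
      rw [this]
      exact hA.inner_field_sub_nonneg hp _ _
  have hd0 : 0 ≤ᵐ[volume.restrict N] d := by
    filter_upwards [ae_restrict_mem hNm] with x hx
    exact (mul_nonneg (hc0 x (hrΩ hx)).le (Real.smoothTransition.nonneg _)).trans (hdc' x hx)
  have hh0 : 0 ≤ᵐ[volume.restrict N] h := Eventually.of_forall fun x =>
    mul_nonneg (by positivity) (add_nonneg (Real.rpow_nonneg (hβ0 x) _)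
      (Real.rpow_nonneg (norm_nonneg _) _))
  have hzero := ae_eq_zero_of_integral_nonpos_of_tendsto (fun j => (iD j).integrableOn) iP ih hdm
    hle hDint hPint hDlim hPlim hd0 hh0
  have hfin : (fun x => Real.smoothTransition (W x)) =ᵐ[volume] fun _ => 0 := by
    filter_upwards [(ae_restrict_iff' hNm).1 hzero] with x hx
    by_cases hxN : x ∈ N
    · have h1 := hdc' x hxN
      rw [hx hxN] at h1
      have h2 := hc0 x (hrΩ hxN)
      have h3 := Real.smoothTransition.nonneg (W x)
      exact le_antisymm (by by_contra! h4; exact absurd h1 (not_le.2 (mul_pos h2 h4))) h3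
    · have : W x = 0 := Function.notMem_support.1 fun h => hxN (hTN (hWT h))
      rw [this, Real.smoothTransition.zero]
  -- Continuity upgrades the almost everywhere identity to every point.
  have hall := (Continuous.ae_eq_iff_eq volume
    (Real.smoothTransition.continuous.comp hWc) continuous_const).1 hfin
  intro x hx
  by_contra! hlt
  have h1 : χ x = 1 := hχK x ⟨hx, hlt.le⟩
  have h2 : Real.smoothTransition (W x) = 0 := congrFun hall x
  rw [Real.smoothTransition.zero_iff_nonpos] at h2
  simp only [hWdef, h1, one_mul] at h2
  linarith

/-! ### Restriction to subdomains and change of sign -/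

section Restriction

variable {n : ℕ} {Ω Ω' : Set (E n)}

theorem IsTestFunction.mono {η : E n → ℝ} (h : IsTestFunction Ω' η) (hΩ : Ω' ⊆ Ω) :
    IsTestFunction Ω η :=
  ⟨h.contDiff, h.hasCompactSupport, h.tsupport_subset.trans hΩ⟩

theorem HasWeakGradient.mono {u : E n → ℝ} {G : E n → E n} (h : HasWeakGradient Ω u G)
    (hΩ : Ω' ⊆ Ω) : HasWeakGradient Ω' u G := by
  refine ⟨h.locallyIntegrableOn.mono_set hΩ, h.locallyIntegrableOn_grad.mono_set hΩ,
    fun η hη v => ?_⟩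
  have z1 : ∀ x ∉ tsupport η, u x * fderiv ℝ η x v = 0 := fun x hx => by
    rw [← inner_gradient_eq_fderiv, gradient_eq_zero_of_notMem_tsupport hx, inner_zero_right,
      mul_zero]
  have z2 : ∀ x ∉ tsupport η, η x * inner ℝ (G x) v = 0 := fun x hx => by
    rw [image_eq_zero_of_notMem_tsupport hx, zero_mul]
  rw [setIntegral_eq_integral_of_tsupport_subset hη.tsupport_subset z1,
    setIntegral_eq_integral_of_tsupport_subset hη.tsupport_subset z2,
    ← setIntegral_eq_integral_of_tsupport_subset (hη.tsupport_subset.trans hΩ) z1,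
    ← setIntegral_eq_integral_of_tsupport_subset (hη.tsupport_subset.trans hΩ) z2]
  exact h.integral_eq η (hη.mono hΩ) v

theorem MemW1pLoc.mono {p : ℝ} {u : E n → ℝ} {G : E n → E n} (h : MemW1pLoc p Ω u G)
    (hΩ : Ω' ⊆ Ω) : MemW1pLoc p Ω' u G :=
  ⟨h.hasWeakGradient.mono hΩ, fun K hK hKΩ => h.memLpLoc K hK (hKΩ.trans hΩ),
    fun K hK hKΩ => h.memLpLoc_grad K hK (hKΩ.trans hΩ)⟩

theorem MemW1pLoc.neg {p : ℝ} {u : E n → ℝ} {G : E n → E n} (h : MemW1pLoc p Ω u G) :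
    MemW1pLoc p Ω (fun x => -u x) (fun x => -G x) := by
  refine ⟨⟨h.hasWeakGradient.locallyIntegrableOn.neg,
    h.hasWeakGradient.locallyIntegrableOn_grad.neg, fun η hη v => ?_⟩,
    fun K hK hKΩ => (h.memLpLoc K hK hKΩ).neg, fun K hK hKΩ => (h.memLpLoc_grad K hK hKΩ).neg⟩
  simp only [neg_mul, inner_neg_left, mul_neg, integral_neg]
  rw [h.hasWeakGradient.integral_eq η hη v]

/-- The nonlinear field is odd; this reduces lower bounds to upper bounds. -/
theorem IsWeakSolution.neg {p : ℝ} {A : ℝ → ℝ} {f u : E n → ℝ} (h : IsWeakSolution p A f Ω u) :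
    IsWeakSolution p A (fun x => -f x) Ω (fun x => -u x) := by
  obtain ⟨G, hG, heq⟩ := h
  refine ⟨fun x => -G x, hG.neg, fun η hη => ?_⟩
  simp only [norm_neg, inner_neg_left, mul_neg, neg_mul, integral_neg]
  rw [heq η hη]

end Restriction

/-! ### Bounds outside a ball -/

/-- Used at a fixed point, with `s = ‖x‖ - R`: the growing part of the barrier vanishes in the limit
because its coefficient is a positive power of `t`. -/
theorem tendsto_barrier_bound {n : ℕ} {p δ Cf ε : ℝ} (hp : 1 < p) (M a s : ℝ) :
    Tendsto (fun t : ℝ => M + t + (C₀ n p δ (Cf + t) ε * a + (t / δ) ^ (1 / (p - 1)) * s))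
      (𝓝[>] 0) (𝓝 (M + C₀ n p δ Cf ε * a)) := by
  have hq : 0 < 1 / (p - 1) := one_div_pos.2 (by linarith)
  have hcont : Continuous fun t : ℝ =>
      M + t + (C₀ n p δ (Cf + t) ε * a + (t / δ) ^ (1 / (p - 1)) * s) := by
    unfold C₀
    have h1 : Continuous fun t : ℝ => ((Cf + t) / (δ * (p - n + ε))) ^ (1 / (p - 1)) :=
      ((continuous_const.add continuous_id).div_const _).rpow_const fun _ => Or.inr hq.le
    have h2 : Continuous fun t : ℝ => (t / δ) ^ (1 / (p - 1)) :=
      (continuous_id.div_const _).rpow_const fun _ => Or.inr hq.le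
    fun_prop
  have := (hcont.tendsto 0).mono_left (nhdsWithin_le_nhds (s := Ioi 0))
  simpa only [add_zero, zero_div, Real.zero_rpow hq.ne', zero_mul] using this

/-- The upper bound in the exterior of the ball of radius `R`, in terms of a bound on its sphere. -/
theorem IsWeakSolution.le_add_of_le_on_sphere {n : ℕ} (hn : 2 ≤ n) {p : ℝ} (hp : (n : ℝ) ≤ p)
    {A : ℝ → ℝ} {δ L : ℝ} (hA : StructureConditions p δ L A) {f : E n → ℝ}
    (hf : LocallyIntegrableOn f (exterior n)) {Cf ε R : ℝ} (hCf : 0 < Cf) (hε : 0 < ε)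
    (hR : 1 ≤ R) (hdecay : ∀ᵐ x : E n, R ≤ ‖x‖ → f x ≤ Cf * ‖x‖ ^ (-(p + ε)))
    {u : E n → ℝ} (hu : IsWeakSolution p A f (exterior n) u)
    (hu_cont : ContinuousOn u {x | R ≤ ‖x‖}) {B : ℝ} (hB : ∀ x, R < ‖x‖ → u x ≤ B) {M : ℝ}
    (hM : ∀ x, ‖x‖ = R → u x ≤ M) (x : E n) (hx : R ≤ ‖x‖) :
    u x ≤ M + C₀ n p δ Cf ε * R ^ (-(ε / (p - 1))) := by
  have hn' : (2 : ℝ) ≤ n := by exact_mod_cast hn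
  have hp2 : 2 ≤ p := hn'.trans hp
  set Ω : Set (E n) := {x | R < ‖x‖}
  have hΩ : IsOpen Ω := isOpen_norm_gt R
  have hΩe : Ω ⊆ exterior n := fun y hy => by
    have hy' : R < ‖y‖ := hy
    simp only [exterior, mem_compl_iff, mem_closedBall_zero_iff, not_le]
    linarith
  obtain ⟨G, hG, hGeq⟩ := hu
  have hueq : ∀ η, IsTestFunction Ω η →
      ∫ x, inner ℝ ((‖G x‖ ^ (p - 2) * A ‖G x‖) • G x) (gradient η x) = ∫ x, f x * η x := by
    intro η hη
    have h1 := hGeq η (hη.mono hΩe)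
    rw [setIntegral_eq_integral_of_tsupport_subset (hη.mono hΩe).tsupport_subset,
      setIntegral_eq_integral_of_tsupport_subset (hη.mono hΩe).tsupport_subset] at h1
    · simpa only [inner_smul_left, conj_trivial] using h1
    · intro y hy; rw [image_eq_zero_of_notMem_tsupport hy, mul_zero]
    · intro y hy; rw [gradient_eq_zero_of_notMem_tsupport hy, inner_zero_right, mul_zero]
  -- The parameter `t` plays three roles: it lifts the barrier strictly above `u` on the sphere, it
  -- is the excess of the source constant that makes the supersolution strict, and it is the
  -- coefficient `k` that makes the barrier unbounded.
  have key : ∀ t : ℝ, 0 < t → u x ≤ M + t + (C₀ n p δ (Cf + t) ε * R ^ (-(ε / (p - 1)))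
      + (t / δ) ^ (1 / (p - 1)) * (‖x‖ - R)) := by
    intro t ht
    obtain ⟨V, H, hVc, hVg, hHc, hVeq, hVinf, hV0, hVle⟩ :=
      hA.exists_barrier hn hp (C := Cf + t) (by linarith) hε ht hR
    -- On the sphere `u ≤ M < M + t + V`, so replacing `R < ‖y‖` by `R ≤ ‖y‖` adds no point and the
    -- set is closed.
    have hKeq : {y | y ∈ Ω ∧ M + t + V y ≤ u y}
        = {y | R ≤ ‖y‖} ∩ (fun y => u y - (M + t + V y)) ⁻¹' Ici 0 := by
      ext y
      constructor
      · rintro ⟨h1, h2⟩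
        exact ⟨mem_ofPred.2 (le_of_lt h1), by simpa using h2⟩
      · rintro ⟨h1, h2⟩
        have h1' : R ≤ ‖y‖ := h1
        have h2' : 0 ≤ u y - (M + t + V y) := h2
        refine ⟨lt_of_le_of_ne h1' fun h => ?_, by linarith⟩
        have := hM y h.symm
        have := hV0 y h1'
        linarith
    have hK : IsCompact {y | y ∈ Ω ∧ M + t + V y ≤ u y} := by
      refine Metric.isCompact_of_isClosed_isBounded ?_ ?_
      · rw [hKeq]
        exact (hu_cont.sub (continuous_const.add hVc).continuousOn).preimage_isClosed_of_isClosed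
          (isClosed_le continuous_const continuous_norm) isClosed_Ici
      -- Beyond `ρ` the barrier exceeds the global bound `B` on `u`.
      · obtain ⟨ρ, hρ⟩ := hVinf (B - M - t)
        refine (Metric.isBounded_ball (x := (0 : E n)) (r := ρ)).subset fun y hy => ?_
        rw [mem_ball_zero_iff]
        by_contra! h
        have h1 := hρ y (le_of_lt hy.1) h
        have h2 := hB y hy.1
        have h3 := hy.2
        linarith
    have hcont : ∀ C : ℝ, ContinuousOn (fun y : E n => C * ‖y‖ ^ (-(p + ε))) Ω := fun C =>
      continuousOn_const.mul (continuousOn_norm_rpow (by linarith) _)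
    have hcomp := hA.le_of_strict_supersolution hp2 hΩ (u := u) (V := fun y => M + t + V y)
      (c := fun y => t * ‖y‖ ^ (-(p + ε))) (hu_cont.mono fun y hy => mem_ofPred.2 (le_of_lt hy)) (hG.mono hΩe)
      (fun y hy => by
        simpa only [hasGradientAt_iff_hasFDerivAt] using
          (hasGradientAt_iff_hasFDerivAt.1 (hVg y hy)).const_add (M + t))
      hHc (hf.mono_set hΩe) (hcont (Cf + t)) (hcont t)
      (fun y hy => by
        have : R < ‖y‖ := hy
        have : 0 < ‖y‖ := by linarith
        positivity)
      (by
        filter_upwards [hdecay] with y hy hyΩ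
        have := hy (le_of_lt hyΩ)
        linarith) hueq hVeq hK
    have h1 := hVle x hx
    have h2 := hV0 x hx
    rcases hx.eq_or_lt with h | h
    · have := hM x h.symm
      linarith
    · have := hcomp x h
      linarith
  exact ge_of_tendsto (tendsto_barrier_bound (by linarith) M _ _)
    (eventually_mem_nhdsWithin.mono key)

/-- Two-sided bounds in the exterior of the ball of radius `R`. -/
theorem IsWeakSolution.bounds_of_continuousOn {n : ℕ} (hn : 2 ≤ n) {p : ℝ} (hp : (n : ℝ) ≤ p)
    {A : ℝ → ℝ} {δ L : ℝ} (hA : StructureConditions p δ L A) {f : E n → ℝ}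
    (hf : LocallyIntegrableOn f (exterior n)) {Cf ε R : ℝ} (hCf : 0 < Cf) (hε : 0 < ε)
    (hR : 1 ≤ R) (hdecay : ∀ᵐ x : E n, R ≤ ‖x‖ → |f x| ≤ Cf * ‖x‖ ^ (-(p + ε)))
    {u : E n → ℝ} (hu : IsWeakSolution p A f (exterior n) u)
    (hu_cont : ContinuousOn u {x | R ≤ ‖x‖}) {B : ℝ} (hB : ∀ x ∈ exterior n, |u x| ≤ B)
    (x : E n) (hx : R ≤ ‖x‖) :
    sphereInf u R - C₀ n p δ Cf ε * R ^ (-(ε / (p - 1))) ≤ u x ∧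
      u x ≤ sphereSup u R + C₀ n p δ Cf ε * R ^ (-(ε / (p - 1))) := by
  have hB' : ∀ x : E n, R < ‖x‖ → |u x| ≤ B := fun y hy => hB y (by
    simp only [exterior, mem_compl_iff, mem_closedBall_zero_iff, not_le]
    linarith)
  have hcomp : IsCompact (u '' Metric.sphere (0 : E n) R) :=
    (isCompact_sphere _ _).image_of_continuousOn (hu_cont.mono fun y hy => by
      rw [mem_sphere_zero_iff_norm] at hy
      exact hy.ge)
  have hmem : ∀ y : E n, ‖y‖ = R → u y ∈ u '' Metric.sphere (0 : E n) R := fun y hy =>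
    mem_image_of_mem u (mem_sphere_zero_iff_norm.2 hy)
  constructor
  -- The upper bound for `-u`, which solves the equation with source `-f`.
  · have := IsWeakSolution.le_add_of_le_on_sphere hn hp hA hf.neg hCf hε hR
      (hdecay.mono fun y hy hyR => (neg_le_abs _).trans (hy hyR)) hu.neg hu_cont.neg
      (fun y hy => (neg_le_abs _).trans (hB' y hy)) (M := -sphereInf u R)
      (fun y hy => neg_le_neg (csInf_le hcomp.bddBelow (hmem y hy))) x hx
    linarith
  · exact IsWeakSolution.le_add_of_le_on_sphere hn hp hA hf hCf hε hR
      (hdecay.mono fun y hy hyR => (le_abs_self _).trans (hy hyR)) hu hu_cont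
      (fun y hy => (le_abs_self _).trans (hB' y hy))
      (fun y hy => le_csSup hcomp.bddAbove (hmem y hy)) x hx

end ExteriorProblem

theorem mainTheorem3 (n : ℕ) (hn : 2 ≤ n) (p : ℝ) (hp : (n : ℝ) ≤ p)
    (A : ℝ → ℝ) (δ L : ℝ) (hA : ExteriorProblem.StructureConditions p δ L A)
    (f : ExteriorProblem.E n → ℝ)
    (hf : LocallyIntegrableOn f (ExteriorProblem.exterior n))
    (Cf ε : ℝ) (hCf : 0 < Cf) (hε : 0 < ε)
    (R₀ : ℝ) (hR₀ : 1 ≤ R₀)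
    (hdecay : ∀ᵐ x : ExteriorProblem.E n, R₀ ≤ ‖x‖ → |f x| ≤ Cf * ‖x‖ ^ (-(p + ε)))
    (u : ExteriorProblem.E n → ℝ)
    (hu : ExteriorProblem.IsWeakSolution p A f (ExteriorProblem.exterior n) u)
    (hu_cont : ContinuousOn u (ExteriorProblem.exterior n))
    (hu_bdd : ∃ B : ℝ, ∀ x ∈ ExteriorProblem.exterior n, |u x| ≤ B) :
    (∀ R : ℝ, R₀ ≤ R → 1 < R → ∀ x : ExteriorProblem.E n, R ≤ ‖x‖ →
      ExteriorProblem.sphereInf u R - ExteriorProblem.C₀ n p δ Cf ε * R ^ (-(ε / (p - 1))) ≤ u x ∧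
      u x ≤ ExteriorProblem.sphereSup u R + ExteriorProblem.C₀ n p δ Cf ε * R ^ (-(ε / (p - 1)))) ∧
    (R₀ = 1 → ContinuousOn u {x : ExteriorProblem.E n | 1 ≤ ‖x‖} →
      ∀ x : ExteriorProblem.E n, 1 ≤ ‖x‖ →
        ExteriorProblem.sphereInf u 1 - ExteriorProblem.C₀ n p δ Cf ε ≤ u x ∧
        u x ≤ ExteriorProblem.sphereSup u 1 + ExteriorProblem.C₀ n p δ Cf ε) := by
  obtain ⟨B, hB⟩ := hu_bdd
  have hdec : ∀ R : ℝ, R₀ ≤ R → ∀ᵐ x : ExteriorProblem.E n,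
      R ≤ ‖x‖ → |f x| ≤ Cf * ‖x‖ ^ (-(p + ε)) := fun R hR =>
    hdecay.mono fun x hx hRx => hx (hR.trans hRx)
  refine ⟨fun R hR hR1 x hx => ?_, fun h1 hcont x hx => ?_⟩
  · refine ExteriorProblem.IsWeakSolution.bounds_of_continuousOn hn hp hA hf hCf hε hR1.le
      (hdec R hR) hu (hu_cont.mono fun y hy => ?_) hB x hx
    have hy' : R ≤ ‖y‖ := hy
    simp only [ExteriorProblem.exterior, mem_compl_iff, mem_closedBall_zero_iff, not_le]
    linarith
  -- Continuity up to the unit sphere is what admits `R = 1`; the power of `R` is then `1`.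
  · have := ExteriorProblem.IsWeakSolution.bounds_of_continuousOn hn hp hA hf hCf hε le_rfl
      (hdec 1 h1.le) hu hcont hB x hx
    simpa only [Real.one_rpow, mul_one] using this
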